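/- Let $n\ge 1$ and let $(M^{n+1},g)$ be a connected smooth Riemannian manifold with (smooth) boundary which is an asymptotically flat half-space with one end. That is, writing $\mathbb{R}^{n+1}_+$ for the closed Euclidean half-space, there are $R>0$, $\tau>0$, a compact set $K\subset M$, and a smooth coordinate chart of $M$, whose image contains $\{x\in\mathbb{R}^{n+1}_+:|x|\ge R\}$, identifying $M\setminus K$ with $\{x\in\mathbb{R}^{n+1}_+:|x|>R\}$, such that in this chart $g_{ij}-\delta_{ij}=O_2(|x|^{-\tau})$, i.e. $$|g_{ij}-\delta_{ij}|+\sum_k|x|\,|\partial_k g_{ij}|+\sum_{k,l}|x|^2\,|\partial_k\partial_l g_{ij}|=O(|x|^{-\tau})\qquad\text{as }|x|\to\infty .$$ Here $M$ includes its boundary, and $C_c^\infty(\overline M)$ denotes the real functions on $M$ that are smooth up to the boundary and have compact support in $M$ (they need not vanish on $\partial M$). For $1<p<n+1$ set $p^*:=\frac{(n+1)p}{n+1-p}$. Then for every $p\in(1,n+1)$ there exists a constant $C=C(M,g,p)>0$ such that for every $\varphi\in C_c^\infty(\overline M)$, $$\left(\int_M|\varphi|^{p^*}\,d\mu_g\right)^{1/p^*}\le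 C\left(\int_M|\nabla\varphi|_g^p\,d\mu_g\right)^{1/p},$$ where both integrals are finite; in particular $\|\varphi\|_{L^{p^*}(M,g)}\le C\,\|\nabla\varphi\|_{L^p(M,g)}$. Moreover, in dimension three ($n=2$) the constants $C(M,g,p)$ may be chosen so that, for some $p_0\in(1,3)$, they are uniformly bounded for $p\in(1,p_0]$. -/

import Mathlib

open Set Filter MeasureTheory Manifold Bundle
open scoped ContDiff Topology ENNReal

noncomputable section

namespace AFHalfSpace

/-- Smooth Riemannian metrics on a manifold `M` with (smooth) boundary, of dimension `n + 1`. -/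
abbrev Metric (n : ℕ) (M : Type*) [TopologicalSpace M]
    [ChartedSpace (EuclideanHalfSpace (n + 1)) M] [IsManifold (𝓡∂ (n + 1)) ∞ M] : Type _ :=
  ContMDiffRiemannianMetric (𝓡∂ (n + 1)) ∞ (EuclideanSpace ℝ (Fin (n + 1)))
    (fun x : M => TangentSpace (𝓡∂ (n + 1)) x)

variable {n : ℕ} {M : Type*} [TopologicalSpace M]
  [ChartedSpace (EuclideanHalfSpace (n + 1)) M]

/-! ### A countable cover by charts -/

variable (n M) in
theorem exists_chart_cover [SecondCountableTopology M] [Nonempty M] :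
    ∃ c : ℕ → M, ⋃ k, (chartAt (EuclideanHalfSpace (n + 1)) (c k)).source = univ := by
  obtain ⟨s, hs, hU⟩ := TopologicalSpace.countable_cover_nhds
    (fun x : M => chart_source_mem_nhds (EuclideanHalfSpace (n + 1)) x)
  have hne : s.Nonempty := by
    by_contra h
    rw [Set.not_nonempty_iff_eq_empty] at h
    subst h
    simp at hU
    exact (Set.empty_ne_univ hU).elim
  obtain ⟨c, rfl⟩ := hs.exists_eq_range hne
  exact ⟨c, by simpa using hU⟩

variable (n M) in
/-- Base points of countably many charts of the atlas that cover `M`. -/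
def coverPoint [SecondCountableTopology M] [Nonempty M] : ℕ → M :=
  (exists_chart_cover n M).choose

variable [IsManifold (𝓡∂ (n + 1)) ∞ M]

/-! ### The gradient -/

/-- The differential of a real function at `x`, as a linear form on the tangent space. -/
def differential (φ : M → ℝ) (x : M) : TangentSpace (𝓡∂ (n + 1)) x →ₗ[ℝ] ℝ :=
  (mfderiv (𝓡∂ (n + 1)) 𝓘(ℝ, ℝ) φ x).toLinearMap

/-- The musical map `v ↦ g(v, ·)` from the tangent space to its dual. -/
def flat (g : Metric n M) (x : M) :
    TangentSpace (𝓡∂ (n + 1)) x →ₗ[ℝ] Module.Dual ℝ (TangentSpace (𝓡∂ (n + 1)) x) where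
  toFun v := (g.inner x v).toLinearMap
  map_add' v w := by ext; simp
  map_smul' c v := by ext; simp

theorem flat_injective (g : Metric n M) (x : M) : Function.Injective (flat g x) := by
  rw [injective_iff_map_eq_zero]
  intro v hv
  by_contra h
  have h1 : g.inner x v v = 0 := congrArg (fun l => l v) hv
  exact absurd h1 (g.pos x v h).ne'

instance (x : M) : FiniteDimensional ℝ (TangentSpace (𝓡∂ (n + 1)) x) :=
  inferInstanceAs (FiniteDimensional ℝ (EuclideanSpace ℝ (Fin (n + 1))))

/-- The Riemannian gradient: the vector `∇φ(x)` with `g(∇φ(x), w) = dφ(x) w` for all `w`. -/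
def gradient (g : Metric n M) (φ : M → ℝ) (x : M) : TangentSpace (𝓡∂ (n + 1)) x :=
  (LinearEquiv.ofInjectiveOfFinrankEq (flat g x) (flat_injective g x)
    Subspace.dual_finrank_eq.symm).symm (differential φ x)

theorem inner_gradient (g : Metric n M) (φ : M → ℝ) (x : M) (w : TangentSpace (𝓡∂ (n + 1)) x) :
    g.inner x (gradient g φ x) w = mfderiv (𝓡∂ (n + 1)) 𝓘(ℝ, ℝ) φ x w := by
  have h := (LinearEquiv.ofInjectiveOfFinrankEq (flat g x) (flat_injective g x)
    Subspace.dual_finrank_eq.symm).apply_symm_apply (differential φ x)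
  exact congrArg (fun l => l w) h

/-- The length `|∇φ|_g` of the gradient. -/
def gradNorm (g : Metric n M) (φ : M → ℝ) (x : M) : ℝ :=
  Real.sqrt (g.inner x (gradient g φ x) (gradient g φ x))

/-! ### Coordinates and the volume measure -/

/-- The coordinate vector field `∂_i` of the chart `e`, at the point with coordinates `y`. -/
def coordVec (e : OpenPartialHomeomorph M (EuclideanHalfSpace (n + 1)))
    (y : EuclideanSpace ℝ (Fin (n + 1))) (i : Fin (n + 1)) :
    TangentSpace (𝓡∂ (n + 1)) ((e.extend (𝓡∂ (n + 1))).symm y) :=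
  mfderivWithin 𝓘(ℝ, EuclideanSpace ℝ (Fin (n + 1))) (𝓡∂ (n + 1))
    (e.extend (𝓡∂ (n + 1))).symm (range (𝓡∂ (n + 1))) y (EuclideanSpace.single i (1 : ℝ))

/-- The coefficients `g_ij = g(∂_i, ∂_j)` of the metric in the chart `e`, as functions of the
coordinates `y`; meaningful for `y` in the image of the chart. -/
def coeff (g : Metric n M) (e : OpenPartialHomeomorph M (EuclideanHalfSpace (n + 1)))
    (i j : Fin (n + 1)) (y : EuclideanSpace ℝ (Fin (n + 1))) : ℝ :=
  g.inner ((e.extend (𝓡∂ (n + 1))).symm y) (coordVec e y i) (coordVec e y j)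

/-- The volume density `√(det g_ij)` in the chart `e`. -/
def density (g : Metric n M) (e : OpenPartialHomeomorph M (EuclideanHalfSpace (n + 1)))
    (y : EuclideanSpace ℝ (Fin (n + 1))) : ℝ :=
  Real.sqrt (Matrix.det (Matrix.of fun i j => coeff g e i j y))

/-- The Riemannian volume on the domain of the chart `e` (and zero outside of it): the measure
`√(det g_ij) dy` on the image of `e`, transported to `M`. -/
def chartVolume [MeasurableSpace M] (g : Metric n M)
    (e : OpenPartialHomeomorph M (EuclideanHalfSpace (n + 1))) : Measure M :=
  (((volume : Measure (EuclideanSpace ℝ (Fin (n + 1)))).restrict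
    (e.extend (𝓡∂ (n + 1))).target).withDensity
      (fun y => ENNReal.ofReal (density g e y))).map (e.extend (𝓡∂ (n + 1))).symm

/-- The Riemannian volume measure `μ_g`: `M` is cut into the disjoint pieces
`U_k \ (U_0 ∪ ⋯ ∪ U_{k-1})`, where `U_0, U_1, …` are the domains of countably many charts that
cover `M`, and each piece is measured in its chart by `√(det g_ij) dy`. -/
def volumeMeasure [MeasurableSpace M] [SecondCountableTopology M] [Nonempty M]
    (g : Metric n M) : Measure M :=
  Measure.sum fun k : ℕ =>
    (chartVolume g (chartAt (EuclideanHalfSpace (n + 1)) (coverPoint n M k))).restrict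
      (disjointed (fun l => (chartAt (EuclideanHalfSpace (n + 1)) (coverPoint n M l)).source) k)

/-! ### Asymptotically flat half-spaces -/

/-- The partial derivative `∂_k f` of a function on the closed half-space `{y | 0 ≤ y 0}`
(one-sided in the normal direction at boundary points). -/
def partialDeriv (k : Fin (n + 1)) (f : EuclideanSpace ℝ (Fin (n + 1)) → ℝ)
    (y : EuclideanSpace ℝ (Fin (n + 1))) : ℝ :=
  fderivWithin ℝ f {z : EuclideanSpace ℝ (Fin (n + 1)) | 0 ≤ z 0} y
    (EuclideanSpace.single k (1 : ℝ))

/-- `Φ` is a chart at infinity with decay rate `τ`: a smooth chart of `M` whose image contains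
`{y ∈ ℝ^{n+1}_+ : |y| ≥ R}`, such that the complement in `M` of the end
`Φ⁻¹ {|y| > R}` is compact, and in which `g_ij - δ_ij = O_2(|y|^{-τ})`. -/
structure IsEndChart (g : Metric n M)
    (Φ : OpenPartialHomeomorph M (EuclideanHalfSpace (n + 1))) (R τ : ℝ) : Prop where
  mem_maximalAtlas : Φ ∈ IsManifold.maximalAtlas (𝓡∂ (n + 1)) ∞ M
  subset_target : {y : EuclideanHalfSpace (n + 1) | R ≤ ‖y.val‖} ⊆ Φ.target
  isCompact_core : IsCompact (Φ.symm '' {y : EuclideanHalfSpace (n + 1) | R < ‖y.val‖})ᶜ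
  decay : ∃ C R₁ : ℝ, ∀ y : EuclideanSpace ℝ (Fin (n + 1)), 0 ≤ y 0 → R < ‖y‖ → R₁ < ‖y‖ →
    ∀ i j : Fin (n + 1),
      |coeff g Φ i j y - (if i = j then 1 else 0)|
        + ∑ k, ‖y‖ * |partialDeriv k (coeff g Φ i j) y|
        + ∑ k, ∑ l, ‖y‖ ^ 2 * |partialDeriv k (partialDeriv l (coeff g Φ i j)) y|
      ≤ C * ‖y‖ ^ (-τ)

/-- `(M, g)` is a one-ended asymptotically flat half-space: outside a compact set there is a single
coordinate chart, onto the half-space outside a ball, in which `g` is asymptotic to the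
Euclidean metric. (Connectedness of `M` is assumed separately; completeness of `g` follows.) -/
def IsAsymptoticallyFlatHalfSpace (g : Metric n M) : Prop :=
  ∃ (Φ : OpenPartialHomeomorph M (EuclideanHalfSpace (n + 1))) (R τ : ℝ),
    0 < R ∧ 0 < τ ∧ IsEndChart g Φ R τ

/-- The Sobolev conjugate exponent `p* = (n+1)p / (n+1-p)` in dimension `n + 1`. -/
def sobolevExponent (n : ℕ) (p : ℝ) : ℝ := (n + 1) * p / (n + 1 - p)

/-- The Sobolev inequality with exponent `p` and constant `C`, for all `φ ∈ C_c^∞(M)` (smooth up to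
the boundary, not required to vanish there), in terms of (finite) integrals and in terms of
`L^p`-norms. -/
def SobolevInequality [MeasurableSpace M] [SecondCountableTopology M] [Nonempty M]
    (g : Metric n M) (p C : ℝ) : Prop :=
  ∀ φ : M → ℝ, ContMDiff (𝓡∂ (n + 1)) 𝓘(ℝ, ℝ) ∞ φ → HasCompactSupport φ →
    Integrable (fun x => |φ x| ^ sobolevExponent n p) (volumeMeasure g) ∧
    Integrable (fun x => gradNorm g φ x ^ p) (volumeMeasure g) ∧
    (∫ x, |φ x| ^ sobolevExponent n p ∂(volumeMeasure g)) ^ (1 / sobolevExponent n p)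
      ≤ C * (∫ x, gradNorm g φ x ^ p ∂(volumeMeasure g)) ^ (1 / p) ∧
    eLpNorm φ (ENNReal.ofReal (sobolevExponent n p)) (volumeMeasure g)
      ≤ ENNReal.ofReal C * eLpNorm (gradNorm g φ) (ENNReal.ofReal p) (volumeMeasure g)

end AFHalfSpace

end

noncomputable section

set_option linter.unusedSectionVars false
set_option linter.unusedVariables false
set_option linter.style.haveILetI false

namespace AFHalfSpace

/-! ### Integral estimates along segments -/

section Segments

variable {E : Type*} [NormedAddCommGroup E] [NormedSpace ℝ E]

/-! Everything reduces to exponent one: for compactly supported `C¹` functions, the `L^((n+1)/n)`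
norm is at most a constant times the total variation `∫ |∇φ|`
(`exists_lintegral_rpow_le_variation`). Applying this to `|φ|^γ` with `γ = pn/(n+1-p)` and using
Hölder's inequality gives every `p ∈ (1, n+1)` with constant proportional to `γ`
(`lintegral_rpow_le`). Since `γ` stays bounded as `p → 1`, the uniform statement in dimension three
comes for free.

On the Euclidean half-space the case of exponent one is the Gagliardo–Nirenberg argument: a function
vanishing far out is the integral of its derivative along the ray in each direction `+e_i`. These
rays never leave the half-space, so no boundary condition is needed (`lintegral_openHalf_rpow_le`).
A cutoff localizes this to half-balls and to the exterior of a ball, at the cost of an `L¹` norm of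
the function on a bounded region. On such regions the metric is comparable with the Euclidean one,
so the estimates pass to `M`.

It remains to bound local `L¹` norms by the variation. In the end, a ray in the direction `e_0`
reaches a place where the function vanishes, which bounds `L¹` norms over bounded parts of the end
(`lintegral_le_lintegral_ray`). A bound near one point of a small half-ball passes to its center by
translating inside this convex set (`lintegral_le_lintegral_translate`). The points with a
neighborhood carrying such a bound therefore form a nonempty clopen set, which is all of `M` by
connectedness. A neighborhood of infinity and finitely many neighborhoods covering the compact
remainder then give the global inequality.

That a compactly supported function vanishes far out in the end chart needs proof: the chart at
infinity is not assumed proper. A compact set containing all of the far end is excluded because the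
end has infinite volume (`IsEndChart.exists_notMem_of_isCompact`). -/

theorem enorm_sub_le_lintegral_segment {U : Set E} (hU : IsOpen U) {u : E → ℝ}
    (hu : ContDiffOn ℝ 1 u U) {a w : E} {L : ℝ} (hL : 0 ≤ L)
    (hseg : ∀ s ∈ Icc 0 L, a + s • w ∈ U) :
    ‖u (a + L • w) - u a‖ₑ ≤ ∫⁻ s in Icc 0 L, ‖w‖ₑ * ‖fderiv ℝ u (a + s • w)‖ₑ := by
  have hc : ContDiff ℝ 1 (fun s : ℝ => a + s • w) := by fun_prop
  have h := enorm_sub_le_lintegral_deriv_of_contDiffOn_Icc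
    (hu.comp hc.contDiffOn hseg) hL
  simp only [Function.comp, zero_smul, add_zero] at h
  refine h.trans (setLIntegral_mono' measurableSet_Icc fun s hs => ?_)
  have hd : HasDerivAt (fun s : ℝ => a + s • w) w s := by
    simpa using ((hasDerivAt_id s).smul_const w).const_add a
  have hud : HasFDerivAt u (fderiv ℝ u (a + s • w)) (a + s • w) :=
    ((hu.contDiffAt (hU.mem_nhds (hseg s hs))).differentiableAt (by simp)).hasFDerivAt
  have hcd := hud.comp_hasDerivAt s hd
  rw [hcd.deriv, mul_comm]
  exact ContinuousLinearMap.le_opENorm _ _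

variable [MeasurableSpace E] [BorelSpace E] [FiniteDimensional ℝ E] (μ : Measure E)
  [μ.IsAddHaarMeasure]

/-- The difference `u (x + a) - u x` is an integral of the derivative over a segment, which lies in
`W` by convexity; integrating in `x` and exchanging the integrals costs only the factor `‖a‖`. -/
theorem lintegral_le_lintegral_translate {W A V : Set E} (hW : IsOpen W) (hWc : Convex ℝ W)
    {u : E → ℝ} (hu : ContDiffOn ℝ 1 u W) (hA : MeasurableSet A) (hV : MeasurableSet V) {a : E}
    (hAW : A ⊆ W) (hVW : V ⊆ W) (hAV : ∀ x ∈ A, x + a ∈ V) :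
    ∫⁻ x in A, ‖u x‖ₑ ∂μ ≤
      ∫⁻ x in V, ‖u x‖ₑ ∂μ + ‖a‖ₑ * ∫⁻ x in W, ‖fderiv ℝ u x‖ₑ ∂μ := by
  -- Extension by zero makes the translation invariance of the integral over the whole space
  -- available.
  set F : E → ℝ≥0∞ := W.indicator fun x => ‖fderiv ℝ u x‖ₑ with hF
  have hFm : Measurable F := (measurable_fderiv ℝ u).enorm.indicator hW.measurableSet
  have hpt : ∀ x ∈ A, ‖u x‖ₑ ≤ ‖u (x + a)‖ₑ + ‖a‖ₑ * ∫⁻ s in Icc (0 : ℝ) 1, F (x + s • a) := by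
    intro x hx
    have hseg : ∀ s ∈ Icc (0 : ℝ) 1, x + s • a ∈ W := by
      intro s hs
      have := hWc (hAW hx) (hVW (hAV x hx)) (sub_nonneg.2 hs.2) hs.1 (by ring)
      convert this using 1
      module
    have h := enorm_sub_le_lintegral_segment hW hu zero_le_one hseg
    rw [one_smul, lintegral_const_mul _ (by fun_prop)] at h
    have h2 : ∫⁻ s in Icc (0 : ℝ) 1, ‖fderiv ℝ u (x + s • a)‖ₑ =
        ∫⁻ s in Icc (0 : ℝ) 1, F (x + s • a) :=
      setLIntegral_congr_fun measurableSet_Icc fun s hs => by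
        simp only [hF, indicator_of_mem (hseg s hs)]
    rw [h2] at h
    calc ‖u x‖ₑ = ‖u (x + a) - (u (x + a) - u x)‖ₑ := by congr 1; ring
      _ ≤ ‖u (x + a)‖ₑ + ‖u (x + a) - u x‖ₑ := enorm_sub_le
      _ ≤ _ := by gcongr
  have hjm : Measurable (Function.uncurry fun (x : E) (s : ℝ) => F (x + s • a)) :=
    hFm.comp (by fun_prop)
  have him : Measurable fun x => ∫⁻ s in Icc (0 : ℝ) 1, F (x + s • a) :=
    hjm.lintegral_prod_right'
  refine (setLIntegral_mono' hA hpt).trans ?_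
  rw [lintegral_add_right _ (him.const_mul _)]
  gcongr ?_ + ?_
  · rw [← lintegral_indicator hA, ← lintegral_indicator hV,
      ← lintegral_add_right_eq_self (μ := μ) (V.indicator _) a]
    refine lintegral_mono fun x => ?_
    by_cases hx : x ∈ A
    · rw [indicator_of_mem hx, indicator_of_mem (hAV x hx)]
    · rw [indicator_of_notMem hx]; exact zero_le
  · rw [lintegral_const_mul _ him]
    refine mul_le_mul_right ?_ _
    rw [lintegral_lintegral_swap hjm.aemeasurable]
    calc ∫⁻ s in Icc (0 : ℝ) 1, ∫⁻ x in A, F (x + s • a) ∂μ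
        ≤ ∫⁻ s in Icc (0 : ℝ) 1, ∫⁻ x, F x ∂μ := by
          refine lintegral_mono fun s => ?_
          refine (setLIntegral_le_lintegral _ _).trans ?_
          rw [lintegral_add_right_eq_self]
      _ = ∫⁻ x in W, ‖fderiv ℝ u x‖ₑ ∂μ := by
          rw [lintegral_const, hF, lintegral_indicator hW.measurableSet]
          simp

/-- If `Ω` is stable under translations by `s • w`, `s ≥ 0`, and `u` vanishes far out in this
direction, then the `L¹`-norm of `u` on a set bounded in the direction `w` is controlled by the
`L¹`-norm of the derivative. -/
theorem lintegral_le_lintegral_ray {Ω A : Set E} (hΩ : IsOpen Ω) {u : E → ℝ}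
    (hu : ContDiffOn ℝ 1 u Ω) (hA : MeasurableSet A) (hAΩ : A ⊆ Ω) {w : E}
    (hw : ‖w‖ = 1) (hray : ∀ x ∈ Ω, ∀ s : ℝ, 0 ≤ s → x + s • w ∈ Ω) {T : ℝ}
    (h0 : ∀ x ∈ Ω, T ≤ ‖x‖ → u x = 0) {ρ : ℝ} (ℓ : E →L[ℝ] ℝ) (hℓ : ℓ w = 1)
    (hAρ : ∀ x ∈ A, |ℓ x| ≤ ρ) :
    ∫⁻ x in A, ‖u x‖ₑ ∂μ ≤ ENNReal.ofReal (2 * ρ) * ∫⁻ x in Ω, ‖fderiv ℝ u x‖ₑ ∂μ := by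
  set F : E → ℝ≥0∞ := Ω.indicator fun x => ‖fderiv ℝ u x‖ₑ with hF
  have hFm : Measurable F := (measurable_fderiv ℝ u).enorm.indicator hΩ.measurableSet
  have hpt : ∀ x ∈ A, ‖u x‖ₑ ≤ ∫⁻ s : ℝ, F (x + s • w) := by
    intro x hx
    have hL : 0 ≤ |T| + ‖x‖ := by positivity
    have hseg : ∀ s ∈ Icc (0 : ℝ) (|T| + ‖x‖), x + s • w ∈ Ω := fun s hs =>
      hray x (hAΩ hx) s hs.1
    have h := enorm_sub_le_lintegral_segment hΩ hu hL hseg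
    -- After time `|T| + ‖x‖` along the ray the norm is at least `|T|`, hence at least `T`.
    have hz : u (x + (|T| + ‖x‖) • w) = 0 := by
      refine h0 _ (hray x (hAΩ hx) _ hL) ?_
      have h1 : ‖(|T| + ‖x‖) • w‖ = |T| + ‖x‖ := by
        rw [norm_smul, hw, mul_one, Real.norm_of_nonneg hL]
      have h2 := norm_sub_le (x + (|T| + ‖x‖) • w) x
      rw [add_sub_cancel_left, h1] at h2
      linarith [le_abs_self T]
    have hwe : ‖w‖ₑ = 1 := by rw [← ofReal_norm, hw, ENNReal.ofReal_one]
    rw [hz, zero_sub, enorm_neg] at h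
    simp only [hwe, one_mul] at h
    refine h.trans ?_
    calc ∫⁻ s in Icc 0 (|T| + ‖x‖), ‖fderiv ℝ u (x + s • w)‖ₑ
        = ∫⁻ s in Icc 0 (|T| + ‖x‖), F (x + s • w) :=
          setLIntegral_congr_fun measurableSet_Icc fun s hs => by
            simp only [hF, indicator_of_mem (hseg s hs)]
      _ ≤ _ := setLIntegral_le_lintegral _ _
  have hjm : Measurable (Function.uncurry fun (x : E) (s : ℝ) => F (x + s • w)) :=
    hFm.comp (by fun_prop)
  have h1 : ∀ s : ℝ, ∫⁻ x in A, F (x + s • w) ∂μ =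
      ∫⁻ z, A.indicator 1 (z - s • w) * F z ∂μ := by
    intro s
    rw [← lintegral_indicator hA, ← lintegral_sub_right_eq_self (μ := μ) _ (s • w)]
    refine lintegral_congr fun z => ?_
    by_cases hz : z - s • w ∈ A
    · simp [hz]
    · simp [hz]
  have hjm2 : Measurable (Function.uncurry fun (s : ℝ) (z : E) =>
      A.indicator (1 : E → ℝ≥0∞) (z - s • w) * F z) :=
    ((measurable_one.indicator hA).comp (by fun_prop)).mul (hFm.comp measurable_snd)
  calc ∫⁻ x in A, ‖u x‖ₑ ∂μ ≤ ∫⁻ x in A, (∫⁻ s : ℝ, F (x + s • w)) ∂μ := setLIntegral_mono' hA hpt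
    _ = ∫⁻ s : ℝ, ∫⁻ z, A.indicator 1 (z - s • w) * F z ∂μ := by
        rw [lintegral_lintegral_swap hjm.aemeasurable]
        simp only [h1]
    _ = ∫⁻ z, (∫⁻ s : ℝ, A.indicator 1 (z - s • w) * F z) ∂μ :=
        lintegral_lintegral_swap hjm2.aemeasurable
    _ ≤ ∫⁻ z, ENNReal.ofReal (2 * ρ) * F z ∂μ := by
        refine lintegral_mono fun z => ?_
        have hm : Measurable fun s : ℝ => A.indicator (1 : E → ℝ≥0∞) (z - s • w) :=
          (measurable_one.indicator hA).comp (by fun_prop)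
        rw [lintegral_mul_const _ hm]
        gcongr
        -- Since `ℓ (z - s • w) = ℓ z - s`, the times at which a ray from `A` can pass through `z`
        -- lie in an interval of length `2ρ`.
        calc ∫⁻ s : ℝ, A.indicator (1 : E → ℝ≥0∞) (z - s • w)
            ≤ ∫⁻ s, (Icc (ℓ z - ρ) (ℓ z + ρ)).indicator 1 s := by
              refine lintegral_mono fun s => ?_
              by_cases hz : z - s • w ∈ A
              · have := hAρ _ hz
                rw [map_sub, map_smul, hℓ, smul_eq_mul, mul_one, abs_le] at this
                rw [indicator_of_mem hz, indicator_of_mem]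
                · rfl
                · exact ⟨by linarith, by linarith⟩
              · rw [indicator_of_notMem hz]; exact zero_le
          _ = ENNReal.ofReal (2 * ρ) := by
              rw [lintegral_indicator_one measurableSet_Icc, Real.volume_Icc]
              congr 1; ring
    _ = _ := by rw [lintegral_const_mul _ hFm, hF, lintegral_indicator hΩ.measurableSet]

end Segments

end AFHalfSpace

namespace AFHalfSpace

variable {n : ℕ}

/-! ### The Sobolev inequality on the half-space -/

variable (n) in
/-- The open half-space. -/
def openHalf : Set (EuclideanSpace ℝ (Fin (n + 1))) := {y | 0 < y 0}

theorem isOpen_openHalf : IsOpen (openHalf n) :=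
  isOpen_lt continuous_const (by fun_prop)

theorem measurableSet_openHalf : MeasurableSet (openHalf n) := isOpen_openHalf.measurableSet

theorem convex_openHalf : Convex ℝ (openHalf n) := by
  intro x hx y hy a b ha hb hab
  simp only [openHalf, mem_ofPred_eq, PiLp.add_apply, PiLp.smul_apply, smul_eq_mul] at *
  rcases ha.eq_or_lt with rfl | ha
  · rw [zero_add] at hab; subst hab; simpa using hy
  · have := mul_pos ha hx
    have := mul_nonneg hb hy.le
    linarith

theorem add_smul_single_mem_openHalf {x : EuclideanSpace ℝ (Fin (n + 1))} (hx : x ∈ openHalf n)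
    (i : Fin (n + 1)) {s : ℝ} (hs : 0 ≤ s) :
    x + s • EuclideanSpace.single i (1 : ℝ) ∈ openHalf n := by
  simp only [openHalf, mem_ofPred_eq, PiLp.add_apply, PiLp.smul_apply, smul_eq_mul] at *
  rw [PiLp.single_apply]
  split_ifs <;> nlinarith

/-- Gagliardo–Nirenberg with one-sided rays. For each `i` the value `|v x|` is bounded by the
integral of `|Dv|` over the part of the coordinate line through `x` in the half-space, and the
product of the `n + 1` bounds, each to the power `1/n`, is integrated by the grid-lines inequality.
-/
theorem lintegral_openHalf_rpow_le (hn : 1 ≤ n) {v : EuclideanSpace ℝ (Fin (n + 1)) → ℝ}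
    (hv : ContDiffOn ℝ 1 v (openHalf n)) {T : ℝ}
    (h0 : ∀ y ∈ openHalf n, T ≤ ‖y‖ → v y = 0) :
    ∫⁻ y in openHalf n, ‖v y‖ₑ ^ ((n + 1 : ℝ) / n) ≤
      (∫⁻ y in openHalf n, ‖fderiv ℝ v y‖ₑ) ^ ((n + 1 : ℝ) / n) := by
  have hn0 : (0 : ℝ) < n := by exact_mod_cast hn
  set F : EuclideanSpace ℝ (Fin (n + 1)) → ℝ≥0∞ :=
    (openHalf n).indicator fun x => ‖fderiv ℝ v x‖ₑ with hF
  have hFm : Measurable F := (measurable_fderiv ℝ v).enorm.indicator measurableSet_openHalf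
  have hp : Real.HolderConjugate (Fintype.card (Fin (n + 1))) ((n + 1 : ℝ) / n) := by
    rw [Real.holderConjugate_iff]
    constructor
    · rw [Fintype.card_fin]; exact_mod_cast Nat.lt_succ_of_le hn
    · rw [Fintype.card_fin]; push_cast; field_simp; ring
  have hpt : ∀ x ∈ openHalf n, ∀ i, ‖v x‖ₑ ≤
      ∫⁻ t, F (WithLp.toLp 2 (Function.update x.ofLp i t)) := by
    intro x hx i
    set w : EuclideanSpace ℝ (Fin (n + 1)) := EuclideanSpace.single i (1 : ℝ) with hw
    have hw1 : ‖w‖ = 1 := by simp [hw]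
    have hL : 0 ≤ |T| + ‖x‖ := by positivity
    have hseg : ∀ s ∈ Icc (0 : ℝ) (|T| + ‖x‖), x + s • w ∈ openHalf n := fun s hs =>
      add_smul_single_mem_openHalf hx i hs.1
    have h := enorm_sub_le_lintegral_segment isOpen_openHalf hv hL hseg
    have hz : v (x + (|T| + ‖x‖) • w) = 0 := by
      refine h0 _ (add_smul_single_mem_openHalf hx i hL) ?_
      have h1 : ‖(|T| + ‖x‖) • w‖ = |T| + ‖x‖ := by
        rw [norm_smul, hw1, mul_one, Real.norm_of_nonneg hL]
      have h2 := norm_sub_le (x + (|T| + ‖x‖) • w) x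
      rw [add_sub_cancel_left, h1] at h2
      linarith [le_abs_self T]
    have hwe : ‖w‖ₑ = 1 := by rw [← ofReal_norm, hw1, ENNReal.ofReal_one]
    rw [hz, zero_sub, enorm_neg] at h
    simp only [hwe, one_mul] at h
    have hupd : ∀ s : ℝ, WithLp.toLp 2 (Function.update x.ofLp i (s + x i)) = x + s • w := by
      intro s
      ext j
      by_cases hj : j = i
      · subst hj; simp [hw, add_comm]
      · simp [hw, hj]
    calc ‖v x‖ₑ ≤ ∫⁻ s in Icc 0 (|T| + ‖x‖), ‖fderiv ℝ v (x + s • w)‖ₑ := h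
      _ = ∫⁻ s in Icc 0 (|T| + ‖x‖), F (x + s • w) :=
          setLIntegral_congr_fun measurableSet_Icc fun s hs => by
            simp only [hF, indicator_of_mem (hseg s hs)]
      _ ≤ ∫⁻ s : ℝ, F (x + s • w) := setLIntegral_le_lintegral _ _
      _ = ∫⁻ s : ℝ, F (WithLp.toLp 2 (Function.update x.ofLp i (s + x i))) := by simp only [hupd]
      _ = _ := lintegral_add_right_eq_self
          (fun t => F (WithLp.toLp 2 (Function.update x.ofLp i t))) (x i)
  have hmp := PiLp.volume_preserving_toLp (Fin (n + 1))
  have hemb : MeasurableEmbedding (WithLp.toLp 2 : (Fin (n + 1) → ℝ) → _) :=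
    (MeasurableEquiv.toLp 2 (Fin (n + 1) → ℝ)).measurableEmbedding
  -- The grid-lines inequality is stated for product measures, hence the passage through
  -- `WithLp.toLp`.
  have key := lintegral_prod_lintegral_pow_le (ι := Fin (n + 1)) (A := fun _ => ℝ)
    (fun _ => volume) hp (f := fun x => F (WithLp.toLp 2 x)) (hFm.comp hemb.measurable)
  calc ∫⁻ y in openHalf n, ‖v y‖ₑ ^ ((n + 1 : ℝ) / n)
      = ∫⁻ y, (openHalf n).indicator (fun y => ‖v y‖ₑ ^ ((n + 1 : ℝ) / n)) y :=
        (lintegral_indicator measurableSet_openHalf _).symm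
    _ = ∫⁻ x : Fin (n + 1) → ℝ, (openHalf n).indicator (fun y => ‖v y‖ₑ ^ ((n + 1 : ℝ) / n))
          (WithLp.toLp 2 x) := (hmp.lintegral_comp_emb hemb _).symm
    _ ≤ ∫⁻ x : Fin (n + 1) → ℝ, ∏ i, (∫⁻ t, F (WithLp.toLp 2 (Function.update x i t))) ^
          ((1 : ℝ) / (Fintype.card (Fin (n + 1)) - 1 : ℝ)) := by
        refine lintegral_mono fun x => ?_
        by_cases hx : WithLp.toLp 2 x ∈ openHalf n
        · rw [indicator_of_mem hx]
          calc ‖v (WithLp.toLp 2 x)‖ₑ ^ ((n + 1 : ℝ) / n)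
              = ∏ _i : Fin (n + 1), ‖v (WithLp.toLp 2 x)‖ₑ ^
                ((1 : ℝ) / (Fintype.card (Fin (n + 1)) - 1 : ℝ)) := by
                rw [Finset.prod_const, Finset.card_univ, Fintype.card_fin, ← ENNReal.rpow_natCast,
                  ← ENNReal.rpow_mul]
                congr 1
                push_cast
                rw [add_sub_cancel_right, div_eq_mul_one_div, mul_comm]
            _ ≤ _ := by
                refine Finset.prod_le_prod' fun i _ => ?_
                refine ENNReal.rpow_le_rpow (hpt _ hx i) ?_
                rw [Fintype.card_fin]; push_cast; simp
        · rw [indicator_of_notMem hx]; exact zero_le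
    _ ≤ _ := key
    _ = _ := by
        rw [← volume_pi, hmp.lintegral_comp_emb hemb F, hF,
          lintegral_indicator measurableSet_openHalf]

/-- The Sobolev inequality for functions on part of the half-space, localized by a cutoff function
`η`. -/
theorem lintegral_cutoff_rpow_le (hn : 1 ≤ n) {Ω K B : Set (EuclideanSpace ℝ (Fin (n + 1)))}
    (hΩ : IsOpen Ω) (hK : MeasurableSet K) (hB : MeasurableSet B)
    {η u : EuclideanSpace ℝ (Fin (n + 1)) → ℝ} (hη : ContDiff ℝ 1 η) (hη1 : ∀ y, |η y| ≤ 1)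
    {L : ℝ} (hL : ∀ y, ‖fderiv ℝ η y‖ ≤ L) (hηΩ : tsupport η ⊆ Ω)
    (hηK : ∀ y, y ∉ K → fderiv ℝ η y = 0) (hηB : ∀ y ∈ B, η y = 1)
    (hu : ContDiffOn ℝ 1 u (Ω ∩ openHalf n)) {T : ℝ}
    (h0 : ∀ y ∈ Ω ∩ openHalf n, T ≤ ‖y‖ → η y = 0 ∨ u y = 0) :
    ∫⁻ y in B ∩ openHalf n, ‖u y‖ₑ ^ ((n + 1 : ℝ) / n) ≤
      ((∫⁻ y in Ω ∩ openHalf n, ‖fderiv ℝ u y‖ₑ) +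
        ENNReal.ofReal L * ∫⁻ y in (Ω ∩ openHalf n) ∩ K, ‖u y‖ₑ) ^ ((n + 1 : ℝ) / n) := by
  have hn0 : (0 : ℝ) < n := by exact_mod_cast hn
  have hO : IsOpen (Ω ∩ openHalf n) := hΩ.inter isOpen_openHalf
  have hout : ∀ y ∉ Ω, (fun z => η z * u z) =ᶠ[𝓝 y] fun _ => 0 := by
    intro y hy
    have : y ∉ tsupport η := fun h => hy (hηΩ h)
    filter_upwards [notMem_tsupport_iff_eventuallyEq.1 this] with z hz
    simp [hz]
  have hv : ContDiffOn ℝ 1 (fun z => η z * u z) (openHalf n) := by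
    intro y hy
    by_cases hyΩ : y ∈ Ω
    · exact (hη.contDiffAt.mul (hu.contDiffAt (hO.mem_nhds ⟨hyΩ, hy⟩))).contDiffWithinAt
    · exact (contDiffAt_const.congr_of_eventuallyEq (hout y hyΩ)).contDiffWithinAt
  -- Product rule; the term with `Dη` lives only on `K`, so only the `L¹` norm of `u` there enters.
  have hder : ∀ y ∈ openHalf n, ‖fderiv ℝ (fun z => η z * u z) y‖ₑ ≤
      (Ω ∩ openHalf n).indicator (fun y => ‖fderiv ℝ u y‖ₑ) y +
      ENNReal.ofReal L * ((Ω ∩ openHalf n) ∩ K).indicator (fun y => ‖u y‖ₑ) y := by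
    intro y hy
    by_cases hyΩ : y ∈ Ω
    · have hd := (hu.contDiffAt (hO.mem_nhds ⟨hyΩ, hy⟩)).differentiableAt (by simp)
      rw [fderiv_fun_mul (hη.differentiable (by simp) y) hd]
      refine (enorm_add_le (E := EuclideanSpace ℝ (Fin (n + 1)) →L[ℝ] ℝ) _ _).trans ?_
      rw [indicator_of_mem (show y ∈ Ω ∩ openHalf n from ⟨hyΩ, hy⟩), enorm_smul, enorm_smul]
      refine add_le_add ?_ ?_
      · refine mul_le_of_le_one_left zero_le ?_
        rw [← ofReal_norm]
        exact ENNReal.ofReal_le_one.2 (hη1 y)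
      · by_cases hyK : y ∈ K
        · rw [indicator_of_mem (show y ∈ (Ω ∩ openHalf n) ∩ K from ⟨⟨hyΩ, hy⟩, hyK⟩), mul_comm]
          refine mul_le_mul_left ?_ _
          rw [← ofReal_norm]
          exact ENNReal.ofReal_le_ofReal (hL y)
        · rw [hηK y hyK, ← ofReal_norm (0 : _ →L[ℝ] ℝ), norm_zero, ENNReal.ofReal_zero, mul_zero]
          exact zero_le
    · rw [(hout y hyΩ).fderiv_eq, fderiv_const_apply, ← ofReal_norm, norm_zero, ENNReal.ofReal_zero]
      exact zero_le
  have hv0 : ∀ y ∈ openHalf n, T ≤ ‖y‖ → η y * u y = 0 := by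
    intro y hy hT
    by_cases hyΩ : y ∈ Ω
    · rcases h0 y ⟨hyΩ, hy⟩ hT with h | h <;> simp [h]
    · exact (hout y hyΩ).eq_of_nhds
  calc ∫⁻ y in B ∩ openHalf n, ‖u y‖ₑ ^ ((n + 1 : ℝ) / n)
      = ∫⁻ y in B ∩ openHalf n, ‖η y * u y‖ₑ ^ ((n + 1 : ℝ) / n) :=
        setLIntegral_congr_fun (hB.inter measurableSet_openHalf) fun y hy => by
          simp only [hηB y hy.1, one_mul]
    _ ≤ ∫⁻ y in openHalf n, ‖η y * u y‖ₑ ^ ((n + 1 : ℝ) / n) :=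
        lintegral_mono_set inter_subset_right
    _ ≤ (∫⁻ y in openHalf n, ‖fderiv ℝ (fun z => η z * u z) y‖ₑ) ^ ((n + 1 : ℝ) / n) :=
        lintegral_openHalf_rpow_le hn hv hv0
    _ ≤ _ := by
        refine ENNReal.rpow_le_rpow ?_ (by positivity)
        refine (setLIntegral_mono' measurableSet_openHalf hder).trans ?_
        rw [lintegral_add_left
          ((measurable_fderiv ℝ u).enorm.indicator hO.measurableSet)]
        have hu' : Measurable (((Ω ∩ openHalf n) ∩ K).indicator (fun y => ‖u y‖ₑ)) := by
          have h1 : Measurable ((Ω ∩ openHalf n).indicator fun y => ‖u y‖ₑ) := by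
            classical
            rw [← piecewise_eq_indicator]
            exact hu.continuousOn.enorm.measurable_piecewise continuousOn_const hO.measurableSet
          rw [inter_comm, ← indicator_indicator]
          exact h1.indicator hK
        rw [lintegral_const_mul _ hu']
        refine add_le_add ?_ (mul_le_mul_right ?_ _)
        · refine (setLIntegral_le_lintegral _ _).trans ?_
          rw [lintegral_indicator hO.measurableSet]
        · refine (setLIntegral_le_lintegral _ _).trans ?_
          rw [lintegral_indicator (hO.measurableSet.inter hK)]

theorem exists_bound_fderiv {E : Type*} [NormedAddCommGroup E] [NormedSpace ℝ E] {f : E → ℝ}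
    (hf : ContDiff ℝ 1 f) (hc : HasCompactSupport f) : ∃ L : ℝ, ∀ y, ‖fderiv ℝ f y‖ ≤ L :=
  (hc.fderiv ℝ).exists_bound_of_continuous (hf.continuous_fderiv (by simp))

/-- Interior form of the localized Sobolev inequality, on half-balls. -/
theorem exists_lintegral_ball_rpow_le (hn : 1 ≤ n) (z : EuclideanSpace ℝ (Fin (n + 1))) {r : ℝ}
    (hr : 0 < r) : ∃ L : ℝ, ∀ u : EuclideanSpace ℝ (Fin (n + 1)) → ℝ,
      ContDiffOn ℝ 1 u (Metric.ball z r ∩ openHalf n) →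
      ∫⁻ y in Metric.ball z (r / 3) ∩ openHalf n, ‖u y‖ₑ ^ ((n + 1 : ℝ) / n) ≤
      ((∫⁻ y in Metric.ball z r ∩ openHalf n, ‖fderiv ℝ u y‖ₑ) +
        ENNReal.ofReal L * ∫⁻ y in Metric.ball z r ∩ openHalf n, ‖u y‖ₑ) ^ ((n + 1 : ℝ) / n) := by
  let η : ContDiffBump z := ⟨r / 3, r / 2, by linarith, by linarith⟩
  obtain ⟨L, hL⟩ := exists_bound_fderiv η.contDiff η.hasCompactSupport
  refine ⟨L, fun u hu => ?_⟩
  have hts : tsupport η ⊆ Metric.ball z r := by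
    rw [η.tsupport_eq]
    exact Metric.closedBall_subset_ball (show r / 2 < r by linarith)
  have h := lintegral_cutoff_rpow_le hn (K := univ) (B := Metric.ball z (r / 3))
    Metric.isOpen_ball MeasurableSet.univ measurableSet_ball η.contDiff
    (fun y => by rw [abs_of_nonneg η.nonneg]; exact η.le_one) hL hts (fun y hy => absurd trivial hy)
    (fun y hy => η.one_of_mem_closedBall (Metric.ball_subset_closedBall hy)) hu
    (T := ‖z‖ + r) (fun y hy hT => ?_)
  · rwa [inter_univ] at h
  · exfalso
    have h1 := mem_ball_iff_norm.1 hy.1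
    have h2 := norm_sub_norm_le y z
    linarith

/-- Exterior form of the localized Sobolev inequality. -/
theorem exists_lintegral_exterior_rpow_le (hn : 1 ≤ n) {R : ℝ} (hR : 0 < R) :
    ∃ L : ℝ, ∀ (u : EuclideanSpace ℝ (Fin (n + 1)) → ℝ) (T : ℝ),
      ContDiffOn ℝ 1 u ({y | R < ‖y‖} ∩ openHalf n) →
      (∀ y ∈ {y | R < ‖y‖} ∩ openHalf n, T ≤ ‖y‖ → u y = 0) →
      ∫⁻ y in {y | R + 2 < ‖y‖} ∩ openHalf n, ‖u y‖ₑ ^ ((n + 1 : ℝ) / n) ≤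
      ((∫⁻ y in {y | R < ‖y‖} ∩ openHalf n, ‖fderiv ℝ u y‖ₑ) +
        ENNReal.ofReal L * ∫⁻ y in ({y | R < ‖y‖} ∩ openHalf n) ∩ Metric.ball 0 (R + 3),
          ‖u y‖ₑ) ^ ((n + 1 : ℝ) / n) := by
  -- The cutoff is `1 - η`: it vanishes up to radius `R + 1`, equals one beyond `R + 2`, and its
  -- derivative is supported in the ball of radius `R + 3`.
  let η : ContDiffBump (0 : EuclideanSpace ℝ (Fin (n + 1))) :=
    ⟨R + 1, R + 2, by linarith, by linarith⟩
  obtain ⟨L, hL⟩ := exists_bound_fderiv η.contDiff η.hasCompactSupport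
  have hd : ∀ y, fderiv ℝ (fun y => 1 - η y) y = - fderiv ℝ η y := fun y => fderiv_const_sub _
  have hopen : ∀ a : ℝ, IsOpen {y : EuclideanSpace ℝ (Fin (n + 1)) | a < ‖y‖} := fun a =>
    isOpen_lt continuous_const continuous_norm
  refine ⟨L, fun u T hu h0 => ?_⟩
  refine lintegral_cutoff_rpow_le (η := fun y => 1 - η y) (T := T) hn (hopen R) measurableSet_ball
    (hopen (R + 2)).measurableSet (contDiff_const.sub η.contDiff)
    (fun y => ?_) (fun y => ?_) ?_ (fun y hy => ?_) (fun y hy => ?_) hu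
    (fun y hy hT => Or.inr (h0 y hy hT))
  · have h1 := η.nonneg (x := y)
    have h2 := η.le_one (x := y)
    rw [abs_le]; constructor <;> linarith
  · rw [hd, norm_neg]; exact hL y
  · have : tsupport (fun y => 1 - η y) ⊆ {y | R + 1 ≤ ‖y‖} := by
      refine closure_minimal (fun y hy => ?_) (isClosed_le continuous_const continuous_norm)
      by_contra h
      refine hy ?_
      have := η.one_of_mem_closedBall (x := y)
        (by rw [mem_closedBall_zero_iff]; exact (not_le.1 h).le)
      simp [this]
    exact this.trans fun y hy => lt_of_lt_of_le (lt_add_one R) hy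
  · rw [hd, neg_eq_zero]
    have h1 : y ∉ tsupport (fderiv ℝ η) := fun h => hy (by
      have h2 := tsupport_fderiv_subset ℝ h
      rw [η.tsupport_eq] at h2
      exact Metric.closedBall_subset_ball (show R + 2 < R + 3 by linarith) h2)
    exact image_eq_zero_of_notMem_tsupport h1
  · have : η y = 0 := η.zero_of_le_dist (by rw [dist_zero_right]; exact le_of_lt hy)
    simp [this]

/-! ### The boundary hyperplane and the size of the half-space -/

theorem volume_hyperplane :
    (volume : Measure (EuclideanSpace ℝ (Fin (n + 1)))) {y | y 0 = 0} = 0 := by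
  have h := Measure.addHaar_submodule (volume : Measure (EuclideanSpace ℝ (Fin (n + 1))))
    (LinearMap.ker (EuclideanSpace.proj (𝕜 := ℝ) (0 : Fin (n + 1))).toLinearMap) (fun h => by
      have h1 : EuclideanSpace.single (0 : Fin (n + 1)) (1 : ℝ) ∈ LinearMap.ker
        (EuclideanSpace.proj (𝕜 := ℝ) (0 : Fin (n + 1))).toLinearMap := h ▸ Submodule.mem_top
      simp at h1)
  convert h using 2
  ext y
  simp

/-- As the boundary is null, integrals over chart images may be taken over the open half-space,
where one-sided and ordinary derivatives agree. -/
theorem range_diff_openHalf_ae :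
    (range (𝓡∂ (n + 1)) : Set (EuclideanSpace ℝ (Fin (n + 1)))) =ᵐ[volume] openHalf n := by
  rw [range_modelWithCornersEuclideanHalfSpace]
  have : ∀ᵐ y : EuclideanSpace ℝ (Fin (n + 1)), y ∉ {y : EuclideanSpace ℝ (Fin (n + 1)) | y 0 = 0} :=
    measure_eq_zero_iff_ae_notMem.1 volume_hyperplane
  filter_upwards [this] with y hy
  refine propext ⟨fun h => lt_of_le_of_ne h (Ne.symm hy), fun h => le_of_lt h⟩

/-- The set and its reflection through the origin cover the space up to a hyperplane and a ball, so
finite volume would make the whole space finite. -/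
theorem volume_exterior (a : ℝ) :
    (volume : Measure (EuclideanSpace ℝ (Fin (n + 1)))) ({y | a < ‖y‖} ∩ openHalf n) = ⊤ := by
  by_contra h
  have h1 : (univ : Set (EuclideanSpace ℝ (Fin (n + 1)))) ⊆
      (({y | a < ‖y‖} ∩ openHalf n) ∪ (-({y | a < ‖y‖} ∩ openHalf n))) ∪
        ({y | y 0 = 0} ∪ Metric.closedBall 0 a) := by
    intro y _
    rcases le_or_gt ‖y‖ a with hy | hy
    · exact Or.inr (Or.inr (by simpa using hy))
    rcases lt_trichotomy (y 0) 0 with h0 | h0 | h0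
    · refine Or.inl (Or.inr ?_)
      rw [Set.mem_neg]
      exact ⟨by simpa using hy, by simpa [openHalf] using h0⟩
    · exact Or.inr (Or.inl h0)
    · exact Or.inl (Or.inl ⟨hy, h0⟩)
  have h2 := (measure_mono (μ := volume) h1).trans (measure_union_le _ _)
  have h3 := measure_union_le (μ := (volume : Measure (EuclideanSpace ℝ (Fin (n + 1)))))
    ({y | a < ‖y‖} ∩ openHalf n) (-({y | a < ‖y‖} ∩ openHalf n))
  have h4 := measure_union_le (μ := (volume : Measure (EuclideanSpace ℝ (Fin (n + 1)))))
    {y | y 0 = 0} (Metric.closedBall 0 a)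
  rw [Measure.measure_neg] at h3
  rw [volume_hyperplane, zero_add] at h4
  have h5 : volume (univ : Set (EuclideanSpace ℝ (Fin (n + 1)))) < ⊤ := by
    refine h2.trans_lt (ENNReal.add_lt_top.2 ⟨h3.trans_lt ?_, h4.trans_lt measure_closedBall_lt_top⟩)
    exact ENNReal.add_lt_top.2 ⟨lt_top_iff_ne_top.2 h, lt_top_iff_ne_top.2 h⟩
  rw [measure_univ_of_isAddLeftInvariant] at h5
  exact lt_irrefl _ h5

end AFHalfSpace

namespace AFHalfSpace

variable {n : ℕ} {M : Type*} [TopologicalSpace M]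
  [ChartedSpace (EuclideanHalfSpace (n + 1)) M] [IsManifold (𝓡∂ (n + 1)) ∞ M]
  {e e' : OpenPartialHomeomorph M (EuclideanHalfSpace (n + 1))}

/-! ### Derivatives of charts -/

theorem target_mem_nhdsWithin {y : EuclideanSpace ℝ (Fin (n + 1))}
    (hy : y ∈ (e.extend (𝓡∂ (n + 1))).target) :
    (e.extend (𝓡∂ (n + 1))).target ∈ 𝓝[range (𝓡∂ (n + 1))] y := by
  rw [e.extend_target]
  refine inter_mem ?_ self_mem_nhdsWithin
  refine mem_nhdsWithin_of_mem_nhds ?_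
  rw [e.extend_target] at hy
  exact (𝓡∂ (n + 1)).continuous_symm.continuousAt.preimage_mem_nhds
    (e.open_target.mem_nhds hy.1)

theorem contMDiffOn_symm_target (he : e ∈ IsManifold.maximalAtlas (𝓡∂ (n + 1)) ∞ M) :
    ContMDiffOn 𝓘(ℝ, EuclideanSpace ℝ (Fin (n + 1))) (𝓡∂ (n + 1)) ∞
      (e.extend (𝓡∂ (n + 1))).symm (e.extend (𝓡∂ (n + 1))).target := by
  rw [e.extend_target']
  exact contMDiffOn_extend_symm he

theorem mdifferentiableWithinAt_symm (he : e ∈ IsManifold.maximalAtlas (𝓡∂ (n + 1)) ∞ M)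
    {y : EuclideanSpace ℝ (Fin (n + 1))} (hy : y ∈ (e.extend (𝓡∂ (n + 1))).target) :
    MDifferentiableWithinAt 𝓘(ℝ, EuclideanSpace ℝ (Fin (n + 1))) (𝓡∂ (n + 1))
      (e.extend (𝓡∂ (n + 1))).symm (range (𝓡∂ (n + 1))) y :=
  ((contMDiffOn_symm_target he y hy).mdifferentiableWithinAt (by simp)).mono_of_mem_nhdsWithin
    (target_mem_nhdsWithin hy)

theorem target_subset_range : (e.extend (𝓡∂ (n + 1))).target ⊆ range (𝓡∂ (n + 1)) := by
  rw [e.extend_target]; exact inter_subset_right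

/-- The derivative of the inverse of a chart. -/
def symmDeriv (e : OpenPartialHomeomorph M (EuclideanHalfSpace (n + 1)))
    (y : EuclideanSpace ℝ (Fin (n + 1))) : EuclideanSpace ℝ (Fin (n + 1)) →L[ℝ]
      TangentSpace (𝓡∂ (n + 1)) ((e.extend (𝓡∂ (n + 1))).symm y) :=
  mfderivWithin 𝓘(ℝ, EuclideanSpace ℝ (Fin (n + 1))) (𝓡∂ (n + 1))
    (e.extend (𝓡∂ (n + 1))).symm (range (𝓡∂ (n + 1))) y

theorem symmDeriv_apply (y w : EuclideanSpace ℝ (Fin (n + 1))) :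
    symmDeriv e y w = ∑ i, w i • coordVec e y i := by
  have : w = ∑ i, w i • EuclideanSpace.single i (1 : ℝ) := by
    ext j
    simp [Finset.sum_apply, Pi.single_apply]
  conv_lhs => rw [this]
  rw [map_sum]
  refine Finset.sum_congr rfl fun i _ => ?_
  rw [map_smul]
  rfl

/-- Composing with the derivative of the chart gives the identity, so the map is injective; equality
of dimensions does the rest. -/
theorem symmDeriv_surjective (he : e ∈ IsManifold.maximalAtlas (𝓡∂ (n + 1)) ∞ M)
    {y : EuclideanSpace ℝ (Fin (n + 1))} (hy : y ∈ (e.extend (𝓡∂ (n + 1))).target) :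
    Function.Surjective (symmDeriv e y) := by
  suffices h : Function.Injective (symmDeriv e y).toLinearMap from
    (LinearMap.injective_iff_surjective (V := EuclideanSpace ℝ (Fin (n + 1)))
      (f := (symmDeriv e y).toLinearMap)).1 h
  have hx : (e.extend (𝓡∂ (n + 1))).symm y ∈ e.source := by
    simpa using (e.extend (𝓡∂ (n + 1))).map_target hy
  have h1 : MDifferentiableAt (𝓡∂ (n + 1)) 𝓘(ℝ, EuclideanSpace ℝ (Fin (n + 1)))
      (e.extend (𝓡∂ (n + 1))) ((e.extend (𝓡∂ (n + 1))).symm y) :=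
    (((e.contMDiffOn_extend he) _ hx).contMDiffAt
      (e.open_source.mem_nhds hx)).mdifferentiableAt (by simp)
  have hu : UniqueMDiffWithinAt 𝓘(ℝ, EuclideanSpace ℝ (Fin (n + 1))) (range (𝓡∂ (n + 1))) y :=
    ((𝓡∂ (n + 1)).uniqueDiffOn y (target_subset_range hy)).uniqueMDiffWithinAt
  have h2 := mfderiv_comp_mfderivWithin y h1 (mdifferentiableWithinAt_symm he hy) hu
  have h3 : mfderivWithin 𝓘(ℝ, EuclideanSpace ℝ (Fin (n + 1)))
      𝓘(ℝ, EuclideanSpace ℝ (Fin (n + 1)))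
      ((e.extend (𝓡∂ (n + 1))) ∘ (e.extend (𝓡∂ (n + 1))).symm) (range (𝓡∂ (n + 1))) y
      = ContinuousLinearMap.id ℝ (EuclideanSpace ℝ (Fin (n + 1))) := by
    rw [mfderivWithin_eq_fderivWithin]
    refine Eq.trans ?_ (fderivWithin_id ((𝓡∂ (n + 1)).uniqueDiffOn y (target_subset_range hy)))
    refine Filter.EventuallyEq.fderivWithin_eq ?_ ((e.extend (𝓡∂ (n + 1))).right_inv hy)
    filter_upwards [target_mem_nhdsWithin hy] with z hz
    exact (e.extend (𝓡∂ (n + 1))).right_inv hz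
  rw [h3] at h2
  intro v w hvw
  have h4 := congrArg (fun l => l v) h2
  have h5 := congrArg (fun l => l w) h2
  change v = _ at h4
  change w = _ at h5
  rw [h4, h5]
  exact congrArg (mfderiv (𝓡∂ (n + 1)) 𝓘(ℝ, EuclideanSpace ℝ (Fin (n + 1)))
      (e.extend (𝓡∂ (n + 1))) ((e.extend (𝓡∂ (n + 1))).symm y)) hvw

theorem symmDeriv_injective (he : e ∈ IsManifold.maximalAtlas (𝓡∂ (n + 1)) ∞ M)
    {y : EuclideanSpace ℝ (Fin (n + 1))} (hy : y ∈ (e.extend (𝓡∂ (n + 1))).target) :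
    Function.Injective (symmDeriv e y) :=
  (LinearMap.injective_iff_surjective (V := EuclideanSpace ℝ (Fin (n + 1)))
      (f := (symmDeriv e y).toLinearMap)).2 (symmDeriv_surjective he hy)

/-- The coordinate field is the tangent map of the inverse chart composed with a constant section of
the model tangent bundle. -/
theorem continuousOn_coordVec (he : e ∈ IsManifold.maximalAtlas (𝓡∂ (n + 1)) ∞ M)
    (i : Fin (n + 1)) :
    ContinuousOn (fun y => (⟨(e.extend (𝓡∂ (n + 1))).symm y, coordVec e y i⟩ :
      TangentBundle (𝓡∂ (n + 1)) M)) (e.extend (𝓡∂ (n + 1))).target := by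
  have hU : UniqueMDiffOn 𝓘(ℝ, EuclideanSpace ℝ (Fin (n + 1)))
      (e.extend (𝓡∂ (n + 1))).target := by
    intro y hy
    have : UniqueDiffWithinAt ℝ (e.extend (𝓡∂ (n + 1))).target y :=
      ((𝓡∂ (n + 1)).uniqueDiffOn y (target_subset_range hy)).mono_nhds
        (nhdsWithin_le_iff.2 (target_mem_nhdsWithin hy))
    exact this.uniqueMDiffWithinAt
  have h1 := (contMDiffOn_symm_target he).continuousOn_tangentMapWithin (by simp) hU
  have h2 : Continuous (fun y : EuclideanSpace ℝ (Fin (n + 1)) =>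
      (⟨y, EuclideanSpace.single i (1 : ℝ)⟩ :
        TangentBundle 𝓘(ℝ, EuclideanSpace ℝ (Fin (n + 1))) (EuclideanSpace ℝ (Fin (n + 1))))) := by
    rw [← (tangentBundleModelSpaceHomeomorph
      𝓘(ℝ, EuclideanSpace ℝ (Fin (n + 1)))).comp_continuous_iff]
    exact continuous_id.prodMk continuous_const
  refine (h1.comp h2.continuousOn (fun y hy => hy)).congr fun y hy => ?_
  simp only [tangentMapWithin, Function.comp, coordVec]
  congr 2
  exact (mfderivWithin_subset target_subset_range (hU y hy)
    (mdifferentiableWithinAt_symm he hy)).symm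

theorem continuousOn_coeff (g : Metric n M)
    (he : e ∈ IsManifold.maximalAtlas (𝓡∂ (n + 1)) ∞ M) (i j : Fin (n + 1)) :
    ContinuousOn (coeff g e i j) (e.extend (𝓡∂ (n + 1))).target := by
  intro y hy
  have hv := continuousOn_coordVec he i y hy
  have hw := continuousOn_coordVec he j y hy
  -- Seen as a continuous inner product on the tangent bundle, `g` pairs continuous fields to
  -- continuous functions.
  letI : RiemannianBundle (fun x : M => TangentSpace (𝓡∂ (n + 1)) x) := ⟨g.toRiemannianMetric⟩
  haveI : IsContinuousRiemannianBundle (EuclideanSpace ℝ (Fin (n + 1)))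
      (fun x : M => TangentSpace (𝓡∂ (n + 1)) x) :=
    ⟨g.inner, g.contMDiff.continuous, fun _ _ _ => rfl⟩
  exact ContinuousWithinAt.inner_bundle (F := EuclideanSpace ℝ (Fin (n + 1)))
    (E := fun x : M => TangentSpace (𝓡∂ (n + 1)) x) hv hw

end AFHalfSpace

namespace AFHalfSpace

variable {n : ℕ} {M : Type*} [TopologicalSpace M]
  [ChartedSpace (EuclideanHalfSpace (n + 1)) M] [IsManifold (𝓡∂ (n + 1)) ∞ M]
  {e e' : OpenPartialHomeomorph M (EuclideanHalfSpace (n + 1))}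

/-! ### The Gram matrix of a chart -/

/-- The matrix `(g_ij)` of the metric in the chart `e`. -/
def gram (g : Metric n M) (e : OpenPartialHomeomorph M (EuclideanHalfSpace (n + 1)))
    (y : EuclideanSpace ℝ (Fin (n + 1))) : Matrix (Fin (n + 1)) (Fin (n + 1)) ℝ :=
  Matrix.of fun i j => coeff g e i j y

theorem inner_symmDeriv (g : Metric n M) (y v w : EuclideanSpace ℝ (Fin (n + 1))) :
    g.inner ((e.extend (𝓡∂ (n + 1))).symm y) (symmDeriv e y v) (symmDeriv e y w)
      = ∑ i, ∑ j, v i * w j * coeff g e i j y := by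
  rw [symmDeriv_apply, symmDeriv_apply,
    map_sum (g.inner ((e.extend (𝓡∂ (n + 1))).symm y)), sum_apply]
  refine Finset.sum_congr rfl fun i _ => ?_
  rw [map_sum]
  refine Finset.sum_congr rfl fun j _ => ?_
  rw [map_smul, map_smul, smul_apply, smul_eq_mul, smul_eq_mul, coeff]
  ring

theorem gram_posDef (g : Metric n M) (he : e ∈ IsManifold.maximalAtlas (𝓡∂ (n + 1)) ∞ M)
    {y : EuclideanSpace ℝ (Fin (n + 1))} (hy : y ∈ (e.extend (𝓡∂ (n + 1))).target) :
    (gram g e y).PosDef := by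
  refine Matrix.PosDef.of_dotProduct_mulVec_pos ?_ fun x hx => ?_
  · ext i j
    simp only [Matrix.conjTranspose_apply, gram, Matrix.of_apply, star_trivial]
    exact g.symm _ _ _
  · have h := inner_symmDeriv (e := e) g y (WithLp.toLp 2 x) (WithLp.toLp 2 x)
    have h2 : star x ⬝ᵥ (gram g e y).mulVec x = ∑ i, ∑ j, x i * x j * coeff g e i j y := by
      simp only [dotProduct, Matrix.mulVec, Finset.mul_sum, gram, Matrix.of_apply, star_trivial]
      refine Finset.sum_congr rfl fun i _ => Finset.sum_congr rfl fun j _ => by ring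
    rw [h2, ← h]
    refine g.pos _ _ fun h0 => hx ?_
    have : symmDeriv e y (WithLp.toLp 2 x) = symmDeriv e y 0 := by rw [h0, map_zero]
    have := symmDeriv_injective he hy this
    simpa using this

theorem density_eq (g : Metric n M) (y : EuclideanSpace ℝ (Fin (n + 1))) :
    density g e y = Real.sqrt (gram g e y).det := rfl

theorem density_pos (g : Metric n M) (he : e ∈ IsManifold.maximalAtlas (𝓡∂ (n + 1)) ∞ M)
    {y : EuclideanSpace ℝ (Fin (n + 1))} (hy : y ∈ (e.extend (𝓡∂ (n + 1))).target) :
    0 < density g e y :=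
  Real.sqrt_pos.2 (gram_posDef g he hy).det_pos

theorem continuousOn_gram (g : Metric n M)
    (he : e ∈ IsManifold.maximalAtlas (𝓡∂ (n + 1)) ∞ M) :
    ContinuousOn (gram g e) (e.extend (𝓡∂ (n + 1))).target :=
  continuousOn_pi.2 fun i => continuousOn_pi.2 fun j => continuousOn_coeff g he i j

theorem continuousOn_density (g : Metric n M)
    (he : e ∈ IsManifold.maximalAtlas (𝓡∂ (n + 1)) ∞ M) :
    ContinuousOn (density g e) (e.extend (𝓡∂ (n + 1))).target :=
  Real.continuous_sqrt.comp_continuousOn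
    ((Continuous.matrix_det continuous_id).comp_continuousOn (continuousOn_gram g he))

/-! ### Change of charts -/

/-- The derivative of the change of charts. -/
def jac (e e' : OpenPartialHomeomorph M (EuclideanHalfSpace (n + 1)))
    (y : EuclideanSpace ℝ (Fin (n + 1))) :
    EuclideanSpace ℝ (Fin (n + 1)) →L[ℝ] EuclideanSpace ℝ (Fin (n + 1)) :=
  fderivWithin ℝ ((𝓡∂ (n + 1)).extendCoordChange e e') (range (𝓡∂ (n + 1))) y

theorem symmDeriv_jac (he : e ∈ IsManifold.maximalAtlas (𝓡∂ (n + 1)) ∞ M)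
    (he' : e' ∈ IsManifold.maximalAtlas (𝓡∂ (n + 1)) ∞ M)
    {y : EuclideanSpace ℝ (Fin (n + 1))}
    (hy : y ∈ ((𝓡∂ (n + 1)).extendCoordChange e e').source) (w : EuclideanSpace ℝ (Fin (n + 1))) :
    (symmDeriv e y w : EuclideanSpace ℝ (Fin (n + 1))) =
      symmDeriv e' ((𝓡∂ (n + 1)).extendCoordChange e e' y) (jac e e' y w) := by
  have hy' : (𝓡∂ (n + 1)).extendCoordChange e e' y ∈ (e'.extend (𝓡∂ (n + 1))).target :=
    (e'.extend (𝓡∂ (n + 1))).map_source hy.2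
  have hyt : y ∈ (e.extend (𝓡∂ (n + 1))).target := hy.1
  have hτ : DifferentiableWithinAt ℝ ((𝓡∂ (n + 1)).extendCoordChange e e')
      (range (𝓡∂ (n + 1))) y :=
    ((𝓡∂ (n + 1)).contDiffWithinAt_extendCoordChange he he' hy).differentiableWithinAt (by simp)
  have hu : UniqueMDiffWithinAt 𝓘(ℝ, EuclideanSpace ℝ (Fin (n + 1))) (range (𝓡∂ (n + 1))) y :=
    ((𝓡∂ (n + 1)).uniqueDiffOn y (target_subset_range hyt)).uniqueMDiffWithinAt
  have hsub : range (𝓡∂ (n + 1)) ⊆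
      ((𝓡∂ (n + 1)).extendCoordChange e e') ⁻¹' (range (𝓡∂ (n + 1))) := by
    intro z _
    exact mem_range_self (f := 𝓡∂ (n + 1)) _
  have h1 := mfderivWithin_comp y (mdifferentiableWithinAt_symm he' hy')
    hτ.mdifferentiableWithinAt hsub hu
  have hev : (e.extend (𝓡∂ (n + 1))).symm =ᶠ[𝓝[range (𝓡∂ (n + 1))] y]
      (e'.extend (𝓡∂ (n + 1))).symm ∘ ((𝓡∂ (n + 1)).extendCoordChange e e') := by
    filter_upwards [(𝓡∂ (n + 1)).extendCoordChange_source_mem_nhdsWithin hy] with z hz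
    exact ((e'.extend (𝓡∂ (n + 1))).left_inv hz.2).symm
  have h2 := hev.mfderivWithin_eq (I := 𝓘(ℝ, EuclideanSpace ℝ (Fin (n + 1))))
    (I' := 𝓡∂ (n + 1)) ((e'.extend (𝓡∂ (n + 1))).left_inv hy.2).symm
  have h3 := congrArg (fun l : EuclideanSpace ℝ (Fin (n + 1)) →L[ℝ]
    EuclideanSpace ℝ (Fin (n + 1)) => l w) (h2.trans h1)
  refine Eq.trans h3 ?_
  rw [mfderivWithin_eq_fderivWithin]
  rfl

theorem inner_congr (g : Metric n M) {x x' : M} (h : x = x')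
    (v w : EuclideanSpace ℝ (Fin (n + 1))) :
    g.inner x (show TangentSpace (𝓡∂ (n + 1)) x from v)
        (show TangentSpace (𝓡∂ (n + 1)) x from w)
      = g.inner x' (show TangentSpace (𝓡∂ (n + 1)) x' from v)
        (show TangentSpace (𝓡∂ (n + 1)) x' from w) := by
  subst h; rfl

/-- The Gram matrices are related by `G = Jᵀ G' J`; take determinants and square roots. -/
theorem density_eq_abs_det_mul (g : Metric n M)
    (he : e ∈ IsManifold.maximalAtlas (𝓡∂ (n + 1)) ∞ M)
    (he' : e' ∈ IsManifold.maximalAtlas (𝓡∂ (n + 1)) ∞ M)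
    {y : EuclideanSpace ℝ (Fin (n + 1))}
    (hy : y ∈ ((𝓡∂ (n + 1)).extendCoordChange e e').source) :
    density g e y = |(jac e e' y).det| *
      density g e' ((𝓡∂ (n + 1)).extendCoordChange e e' y) := by
  set J : Matrix (Fin (n + 1)) (Fin (n + 1)) ℝ := LinearMap.toMatrix
    (EuclideanSpace.basisFun (Fin (n + 1)) ℝ).toBasis
    (EuclideanSpace.basisFun (Fin (n + 1)) ℝ).toBasis (jac e e' y).toLinearMap with hJ
  have hJa : ∀ k i, J k i = jac e e' y (EuclideanSpace.single i 1) k := by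
    intro k i
    simp [hJ, LinearMap.toMatrix_apply]
  have hG : gram g e y =
      J.transpose * gram g e' ((𝓡∂ (n + 1)).extendCoordChange e e' y) * J := by
    ext i j
    have h1 : coeff g e i j y = g.inner
        ((e'.extend (𝓡∂ (n + 1))).symm ((𝓡∂ (n + 1)).extendCoordChange e e' y))
        (symmDeriv e' ((𝓡∂ (n + 1)).extendCoordChange e e' y)
          (jac e e' y (EuclideanSpace.single i 1)))
        (symmDeriv e' ((𝓡∂ (n + 1)).extendCoordChange e e' y)
          (jac e e' y (EuclideanSpace.single j 1))) := by
      have hi := symmDeriv_jac he he' hy (EuclideanSpace.single i 1)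
      have hj := symmDeriv_jac he he' hy (EuclideanSpace.single j 1)
      have h0 := inner_congr g ((e'.extend (𝓡∂ (n + 1))).left_inv hy.2).symm
        (symmDeriv e y (EuclideanSpace.single i 1)) (symmDeriv e y (EuclideanSpace.single j 1))
      refine Eq.trans h0 ?_
      rw [hi, hj]
      rfl
    rw [inner_symmDeriv] at h1
    simp only [gram, Matrix.mul_apply, Matrix.of_apply, Matrix.transpose_apply, hJa]
    rw [h1, Finset.sum_comm]
    refine Finset.sum_congr rfl fun k _ => ?_
    rw [Finset.sum_mul]
    refine Finset.sum_congr rfl fun l _ => ?_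
    ring
  have hdet : (jac e e' y).det = J.det := (LinearMap.det_toMatrix _ _).symm
  rw [density_eq, density_eq, hG, Matrix.det_mul, Matrix.det_mul, Matrix.det_transpose, hdet,
    mul_right_comm, Real.sqrt_mul (mul_self_nonneg _), Real.sqrt_mul_self_eq_abs]

end AFHalfSpace

namespace AFHalfSpace

variable {n : ℕ} {M : Type*} [TopologicalSpace M]
  [ChartedSpace (EuclideanHalfSpace (n + 1)) M] [IsManifold (𝓡∂ (n + 1)) ∞ M]
  {e e' : OpenPartialHomeomorph M (EuclideanHalfSpace (n + 1))}

/-! ### Integration in charts -/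

theorem isClosed_range_model : IsClosed (range (𝓡∂ (n + 1))) := (𝓡∂ (n + 1)).isClosed_range

theorem measurableSet_extend_target :
    MeasurableSet (e.extend (𝓡∂ (n + 1))).target := by
  rw [e.extend_target]
  exact ((e.open_target.preimage (𝓡∂ (n + 1)).continuous_symm).measurableSet).inter
    isClosed_range_model.measurableSet

theorem measurableSet_extendCoordChange_source :
    MeasurableSet ((𝓡∂ (n + 1)).extendCoordChange e e').source := by
  rw [(𝓡∂ (n + 1)).extendCoordChange_source, (𝓡∂ (n + 1)).image_eq]
  exact (((e.symm.trans e').open_source.preimage (𝓡∂ (n + 1)).continuous_symm).measurableSet).inter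
    isClosed_range_model.measurableSet

variable [MeasurableSpace M] [BorelSpace M]

theorem aemeasurable_extend_symm :
    AEMeasurable (e.extend (𝓡∂ (n + 1))).symm
      ((volume : Measure (EuclideanSpace ℝ (Fin (n + 1)))).restrict
        (e.extend (𝓡∂ (n + 1))).target) :=
  e.continuousOn_extend_symm.aemeasurable measurableSet_extend_target

theorem lintegral_chartVolume (g : Metric n M)
    (he : e ∈ IsManifold.maximalAtlas (𝓡∂ (n + 1)) ∞ M) {f : M → ℝ≥0∞} (hf : Measurable f) :
    ∫⁻ x, f x ∂(chartVolume g e) = ∫⁻ y in (e.extend (𝓡∂ (n + 1))).target,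
      ENNReal.ofReal (density g e y) * f ((e.extend (𝓡∂ (n + 1))).symm y) := by
  have hd : AEMeasurable (fun y => ENNReal.ofReal (density g e y))
      ((volume : Measure (EuclideanSpace ℝ (Fin (n + 1)))).restrict
        (e.extend (𝓡∂ (n + 1))).target) :=
    ((continuousOn_density g he).aemeasurable measurableSet_extend_target).ennreal_ofReal
  rw [chartVolume, lintegral_map' hf.aemeasurable
    (aemeasurable_extend_symm.mono_ac (withDensity_absolutelyContinuous _ _))]
  exact lintegral_withDensity_eq_lintegral_mul₀ hd (hf.comp_aemeasurable aemeasurable_extend_symm)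

theorem setLIntegral_chartVolume (g : Metric n M)
    (he : e ∈ IsManifold.maximalAtlas (𝓡∂ (n + 1)) ∞ M) {f : M → ℝ≥0∞} (hf : Measurable f) :
    ∫⁻ x in e'.source, f x ∂(chartVolume g e) =
      ∫⁻ y in ((𝓡∂ (n + 1)).extendCoordChange e e').source,
      ENNReal.ofReal (density g e y) * f ((e.extend (𝓡∂ (n + 1))).symm y) := by
  have hm : MeasurableSet e'.source := e'.open_source.measurableSet
  rw [← lintegral_indicator hm, lintegral_chartVolume g he (hf.indicator hm)]
  have h : ∀ y ∈ (e.extend (𝓡∂ (n + 1))).target, ENNReal.ofReal (density g e y) *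
      (e'.source.indicator f) ((e.extend (𝓡∂ (n + 1))).symm y) =
      (((𝓡∂ (n + 1)).extendCoordChange e e').source.indicator fun y =>
        ENNReal.ofReal (density g e y) * f ((e.extend (𝓡∂ (n + 1))).symm y)) y := by
    intro y hy
    by_cases hs : (e.extend (𝓡∂ (n + 1))).symm y ∈ e'.source
    · rw [indicator_of_mem hs, indicator_of_mem]
      exact ⟨hy, by simpa using hs⟩
    · rw [indicator_of_notMem hs, indicator_of_notMem, mul_zero]
      exact fun h => hs (by simpa using h.2)
  rw [setLIntegral_congr_fun measurableSet_extend_target h,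
    lintegral_indicator measurableSet_extendCoordChange_source,
    Measure.restrict_restrict measurableSet_extendCoordChange_source, inter_eq_left.2]
  exact fun y hy => hy.1

/-- In the change of variables formula the Jacobian factor is exactly the quotient of the two
densities. -/
theorem chartVolume_restrict (g : Metric n M)
    (he : e ∈ IsManifold.maximalAtlas (𝓡∂ (n + 1)) ∞ M)
    (he' : e' ∈ IsManifold.maximalAtlas (𝓡∂ (n + 1)) ∞ M) :
    (chartVolume g e).restrict e'.source = (chartVolume g e').restrict e.source := by
  refine Measure.ext_of_lintegral _ fun f hf => ?_
  rw [setLIntegral_chartVolume g he hf, setLIntegral_chartVolume g he' hf]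
  have himg : ((𝓡∂ (n + 1)).extendCoordChange e' e).source =
      (𝓡∂ (n + 1)).extendCoordChange e e' '' ((𝓡∂ (n + 1)).extendCoordChange e e').source := by
    rw [PartialEquiv.image_source_eq_target, ← (𝓡∂ (n + 1)).extendCoordChange_symm]
    rfl
  have hder : ∀ y ∈ ((𝓡∂ (n + 1)).extendCoordChange e e').source,
      HasFDerivWithinAt ((𝓡∂ (n + 1)).extendCoordChange e e') (jac e e' y)
        ((𝓡∂ (n + 1)).extendCoordChange e e').source y := fun y hy =>
    (((𝓡∂ (n + 1)).contDiffWithinAt_extendCoordChange he he' hy).differentiableWithinAt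
      (by simp)).hasFDerivWithinAt.mono fun z hz => target_subset_range (e := e) hz.1
  rw [himg, lintegral_image_eq_lintegral_abs_det_fderiv_mul volume
    measurableSet_extendCoordChange_source hder ((𝓡∂ (n + 1)).extendCoordChange e e').injOn]
  refine setLIntegral_congr_fun measurableSet_extendCoordChange_source fun y hy => ?_
  have hs : (e'.extend (𝓡∂ (n + 1))).symm ((𝓡∂ (n + 1)).extendCoordChange e e' y) =
      (e.extend (𝓡∂ (n + 1))).symm y := (e'.extend (𝓡∂ (n + 1))).left_inv hy.2
  simp only [hs]
  rw [density_eq_abs_det_mul g he he' hy, ENNReal.ofReal_mul (abs_nonneg _), mul_assoc]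

/-- This frees `volumeMeasure` from the chosen cover: on each disjoint piece the chart of the cover
may be replaced by `e`, and the pieces add up. -/
theorem volumeMeasure_restrict_source [SecondCountableTopology M] [Nonempty M] (g : Metric n M)
    (he : e ∈ IsManifold.maximalAtlas (𝓡∂ (n + 1)) ∞ M) :
    (volumeMeasure g).restrict e.source = chartVolume g e := by
  set c : ℕ → OpenPartialHomeomorph M (EuclideanHalfSpace (n + 1)) :=
    fun k => chartAt (EuclideanHalfSpace (n + 1)) (coverPoint n M k) with hc
  have hcov : ⋃ k, (c k).source = univ := (exists_chart_cover n M).choose_spec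
  have hcm : ∀ k, c k ∈ IsManifold.maximalAtlas (𝓡∂ (n + 1)) ∞ M := fun k =>
    IsManifold.chart_mem_maximalAtlas _
  have hD : ∀ k, MeasurableSet (disjointed (fun l => (c l).source) k) := fun k =>
    MeasurableSet.disjointed (fun l => (c l).open_source.measurableSet) k
  have h1 : ∀ k, (((chartVolume g (c k)).restrict
      (disjointed (fun l => (c l).source) k)).restrict e.source) =
      (chartVolume g e).restrict (disjointed (fun l => (c l).source) k) := by
    intro k
    rw [Measure.restrict_restrict e.open_source.measurableSet, inter_comm,
      ← Measure.restrict_restrict (hD k), chartVolume_restrict g (hcm k) he,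
      Measure.restrict_restrict (hD k), inter_eq_left.2 (disjointed_subset _ k)]
  change (Measure.sum fun k => (chartVolume g (c k)).restrict
      (disjointed (fun l => (c l).source) k)).restrict e.source = _
  rw [Measure.restrict_sum _ e.open_source.measurableSet]
  simp only [h1]
  rw [← Measure.restrict_iUnion (disjoint_disjointed _) hD, iUnion_disjointed, hcov,
    Measure.restrict_univ]

/-- Integrals over open subsets of a chart domain are computed in the chart. -/
theorem setLIntegral_volumeMeasure [SecondCountableTopology M] [Nonempty M] (g : Metric n M)
    (he : e ∈ IsManifold.maximalAtlas (𝓡∂ (n + 1)) ∞ M) {f : M → ℝ≥0∞} (hf : Measurable f)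
    {A : Set (EuclideanSpace ℝ (Fin (n + 1)))} (hA : IsOpen A) :
    ∫⁻ x in e.source ∩ e.extend (𝓡∂ (n + 1)) ⁻¹' A, f x ∂(volumeMeasure g) =
      ∫⁻ y in (e.extend (𝓡∂ (n + 1))).target ∩ A,
        ENNReal.ofReal (density g e y) * f ((e.extend (𝓡∂ (n + 1))).symm y) := by
  set U := e.source ∩ e.extend (𝓡∂ (n + 1)) ⁻¹' A with hU
  have hm : MeasurableSet U := (e.isOpen_extend_preimage hA).measurableSet
  rw [← inter_eq_left.2 (show U ⊆ e.source from inter_subset_left), ← Measure.restrict_restrict hm,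
    volumeMeasure_restrict_source g he, ← lintegral_indicator hm,
    lintegral_chartVolume g he (hf.indicator hm), inter_comm _ A,
    ← Measure.restrict_restrict hA.measurableSet, ← lintegral_indicator hA.measurableSet]
  refine setLIntegral_congr_fun measurableSet_extend_target fun y hy => ?_
  by_cases hyA : y ∈ A
  · have : (e.extend (𝓡∂ (n + 1))).symm y ∈ U := by
      refine ⟨by simpa using (e.extend (𝓡∂ (n + 1))).map_target hy, ?_⟩
      rw [mem_preimage, (e.extend (𝓡∂ (n + 1))).right_inv hy]; exact hyA
    simp only [indicator_of_mem this, indicator_of_mem hyA]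
  · have : (e.extend (𝓡∂ (n + 1))).symm y ∉ U := by
      rintro ⟨_, h⟩
      rw [mem_preimage, (e.extend (𝓡∂ (n + 1))).right_inv hy] at h; exact hyA h
    simp only [indicator_of_notMem this, indicator_of_notMem hyA, mul_zero]

end AFHalfSpace

namespace AFHalfSpace

variable {n : ℕ} {M : Type*} [TopologicalSpace M]
  [ChartedSpace (EuclideanHalfSpace (n + 1)) M] [IsManifold (𝓡∂ (n + 1)) ∞ M]
  {e e' : OpenPartialHomeomorph M (EuclideanHalfSpace (n + 1))} {φ : M → ℝ}

/-! ### The gradient in charts -/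

theorem contDiffOn_comp_symm (he : e ∈ IsManifold.maximalAtlas (𝓡∂ (n + 1)) ∞ M)
    (hφ : ContMDiff (𝓡∂ (n + 1)) 𝓘(ℝ, ℝ) 1 φ) :
    ContDiffOn ℝ 1 (φ ∘ (e.extend (𝓡∂ (n + 1))).symm) (e.extend (𝓡∂ (n + 1))).target :=
  contMDiffOn_iff_contDiffOn.1
    (hφ.comp_contMDiffOn ((contMDiffOn_symm_target he).of_le (by simp)))

theorem fderivWithin_comp_symm (he : e ∈ IsManifold.maximalAtlas (𝓡∂ (n + 1)) ∞ M)
    (hφ : ContMDiff (𝓡∂ (n + 1)) 𝓘(ℝ, ℝ) 1 φ) {y : EuclideanSpace ℝ (Fin (n + 1))}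
    (hy : y ∈ (e.extend (𝓡∂ (n + 1))).target) (w : EuclideanSpace ℝ (Fin (n + 1))) :
    fderivWithin ℝ (φ ∘ (e.extend (𝓡∂ (n + 1))).symm) (range (𝓡∂ (n + 1))) y w =
      mfderiv (𝓡∂ (n + 1)) 𝓘(ℝ, ℝ) φ ((e.extend (𝓡∂ (n + 1))).symm y) (symmDeriv e y w) := by
  have hu : UniqueMDiffWithinAt 𝓘(ℝ, EuclideanSpace ℝ (Fin (n + 1))) (range (𝓡∂ (n + 1))) y :=
    ((𝓡∂ (n + 1)).uniqueDiffOn y (target_subset_range hy)).uniqueMDiffWithinAt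
  have h := mfderiv_comp_mfderivWithin (I'' := 𝓘(ℝ, ℝ)) (g := φ) y
    ((hφ _).mdifferentiableAt (by simp)) (mdifferentiableWithinAt_symm he hy) hu
  rw [mfderivWithin_eq_fderivWithin] at h
  exact congrArg (fun l : EuclideanSpace ℝ (Fin (n + 1)) →L[ℝ] ℝ => l w) h

theorem uniqueDiffOn_target : UniqueDiffOn ℝ (e.extend (𝓡∂ (n + 1))).target := fun y hy =>
  ((𝓡∂ (n + 1)).uniqueDiffOn y (target_subset_range hy)).mono_nhds
        (nhdsWithin_le_iff.2 (target_mem_nhdsWithin hy))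

theorem continuousOn_fderivWithin_comp_symm
    (he : e ∈ IsManifold.maximalAtlas (𝓡∂ (n + 1)) ∞ M)
    (hφ : ContMDiff (𝓡∂ (n + 1)) 𝓘(ℝ, ℝ) 1 φ) :
    ContinuousOn (fderivWithin ℝ (φ ∘ (e.extend (𝓡∂ (n + 1))).symm) (range (𝓡∂ (n + 1))))
      (e.extend (𝓡∂ (n + 1))).target := by
  refine ((contDiffOn_comp_symm he hφ).continuousOn_fderivWithin uniqueDiffOn_target
    le_rfl).congr fun y hy => ?_
  refine (fderivWithin_of_mem_nhdsWithin (target_mem_nhdsWithin hy)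
    ((𝓡∂ (n + 1)).uniqueDiffOn y (target_subset_range hy))
    ((contDiffOn_comp_symm he hφ y hy).differentiableWithinAt (by simp)))

theorem eq_gradient (g : Metric n M) {x : M} {v : TangentSpace (𝓡∂ (n + 1)) x}
    (h : ∀ w, g.inner x v w = mfderiv (𝓡∂ (n + 1)) 𝓘(ℝ, ℝ) φ x w) : v = gradient g φ x := by
  refine flat_injective g x ?_
  ext w
  exact (h w).trans (inner_gradient g φ x w).symm

/-- This is `|∇φ|² = bᵀ G⁻¹ b`. Writing the inverse as adjugate over determinant makes continuity in
the coordinates evident. -/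
theorem inner_gradient_self (g : Metric n M)
    (he : e ∈ IsManifold.maximalAtlas (𝓡∂ (n + 1)) ∞ M)
    (hφ : ContMDiff (𝓡∂ (n + 1)) 𝓘(ℝ, ℝ) 1 φ) {y : EuclideanSpace ℝ (Fin (n + 1))}
    (hy : y ∈ (e.extend (𝓡∂ (n + 1))).target) (b : Fin (n + 1) → ℝ)
    (hb : b = fun i => fderivWithin ℝ (φ ∘ (e.extend (𝓡∂ (n + 1))).symm) (range (𝓡∂ (n + 1))) y
      (EuclideanSpace.single i 1)) :
    g.inner ((e.extend (𝓡∂ (n + 1))).symm y)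
        (gradient g φ ((e.extend (𝓡∂ (n + 1))).symm y))
        (gradient g φ ((e.extend (𝓡∂ (n + 1))).symm y)) =
      b ⬝ᵥ ((gram g e y).det⁻¹ • (gram g e y).adjugate).mulVec b := by
  set G := gram g e y with hG
  have hGp : G.PosDef := gram_posDef g he hy
  set a : Fin (n + 1) → ℝ := (G.det⁻¹ • G.adjugate).mulVec b with ha
  have hGa : G.mulVec a = b := by
    rw [ha, Matrix.mulVec_mulVec, Matrix.mul_smul, Matrix.mul_adjugate, smul_smul,
      inv_mul_cancel₀ hGp.det_pos.ne', one_smul, Matrix.one_mulVec]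
  have hdw : ∀ w : EuclideanSpace ℝ (Fin (n + 1)),
      fderivWithin ℝ (φ ∘ (e.extend (𝓡∂ (n + 1))).symm) (range (𝓡∂ (n + 1))) y w =
        ∑ i, w i * b i := by
    intro w
    have : w = ∑ i, w i • EuclideanSpace.single i (1 : ℝ) := by
      ext j
      simp [Finset.sum_apply, Pi.single_apply]
    conv_lhs => rw [this]
    rw [map_sum]
    refine Finset.sum_congr rfl fun i _ => ?_
    rw [map_smul, hb, smul_eq_mul]
  have hv : symmDeriv e y (WithLp.toLp 2 a) = gradient g φ ((e.extend (𝓡∂ (n + 1))).symm y) := by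
    refine eq_gradient g fun w => ?_
    obtain ⟨w, rfl⟩ := symmDeriv_surjective he hy w
    rw [inner_symmDeriv, ← fderivWithin_comp_symm he hφ hy, hdw, Finset.sum_comm]
    refine Finset.sum_congr rfl fun j _ => ?_
    rw [← hGa, Matrix.mulVec, dotProduct, Finset.mul_sum]
    refine Finset.sum_congr rfl fun i _ => ?_
    have : coeff g e i j y = G j i := g.symm _ _ _
    rw [this]
    simp only
    ring
  rw [inner_gradient]
  conv_lhs => rw [← hv]
  rw [← fderivWithin_comp_symm he hφ hy, hdw, dotProduct]
  exact Finset.sum_congr rfl fun i _ => mul_comm _ _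

theorem continuous_gradNorm (g : Metric n M) (hφ : ContMDiff (𝓡∂ (n + 1)) 𝓘(ℝ, ℝ) 1 φ) :
    Continuous (gradNorm g φ) := by
  refine continuous_iff_continuousAt.2 fun x => ?_
  set e := chartAt (EuclideanHalfSpace (n + 1)) x with hedef
  have he : e ∈ IsManifold.maximalAtlas (𝓡∂ (n + 1)) ∞ M := IsManifold.chart_mem_maximalAtlas x
  set b : EuclideanSpace ℝ (Fin (n + 1)) → Fin (n + 1) → ℝ := fun y i =>
    fderivWithin ℝ (φ ∘ (e.extend (𝓡∂ (n + 1))).symm) (range (𝓡∂ (n + 1))) y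
      (EuclideanSpace.single i 1) with hb
  have hbc : ContinuousOn b (e.extend (𝓡∂ (n + 1))).target :=
    continuousOn_pi.2 fun i => (continuousOn_fderivWithin_comp_symm he hφ).clm_apply
      continuousOn_const
  have hGc := continuousOn_gram g he
  have hF : ContinuousOn (fun y => Real.sqrt (b y ⬝ᵥ
      ((gram g e y).det⁻¹ • (gram g e y).adjugate).mulVec (b y)))
      (e.extend (𝓡∂ (n + 1))).target := by
    refine Real.continuous_sqrt.comp_continuousOn ?_
    have h1 : ContinuousOn (fun y => (gram g e y).det⁻¹ • (gram g e y).adjugate)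
        (e.extend (𝓡∂ (n + 1))).target := by
      refine ContinuousOn.smul (ContinuousOn.inv₀
        ((Continuous.matrix_det continuous_id).comp_continuousOn hGc)
        fun y hy => (gram_posDef g he hy).det_pos.ne')
        ((Continuous.matrix_adjugate continuous_id).comp_continuousOn hGc)
    simp only [dotProduct, Matrix.mulVec]
    refine continuousOn_finsetSum _ fun i _ => ((continuousOn_pi.1 hbc i).mul ?_)
    refine continuousOn_finsetSum _ fun j _ => ContinuousOn.mul ?_ (continuousOn_pi.1 hbc j)
    exact continuousOn_pi.1 (continuousOn_pi.1 h1 i) j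
  have hc : ContinuousOn (gradNorm g φ) e.source := by
    have := hF.comp e.continuousOn_extend (fun z hz => (e.extend (𝓡∂ (n + 1))).map_source hz)
    rw [e.extend_source] at this
    refine this.congr fun z hz => ?_
    have hz' : z ∈ (e.extend (𝓡∂ (n + 1))).source := by rwa [e.extend_source]
    have h := inner_gradient_self g he hφ ((e.extend (𝓡∂ (n + 1))).map_source hz')
      (b (e.extend (𝓡∂ (n + 1)) z)) rfl
    rw [(e.extend (𝓡∂ (n + 1))).left_inv hz'] at h
    simp only [gradNorm, Function.comp, h]
  exact hc.continuousAt (e.open_source.mem_nhds (mem_chart_source _ x))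

/-! ### Cauchy–Schwarz and the chain rule for the gradient -/

theorem inner_self_nonneg (g : Metric n M) (x : M) (v : TangentSpace (𝓡∂ (n + 1)) x) :
    0 ≤ g.inner x v v := by
  by_cases h : v = 0
  · subst h
    exact (congrArg (fun l => l 0) (map_zero (g.inner x))).symm.le
  · exact (g.pos x v h).le

theorem inner_sq_le (g : Metric n M) (x : M) (v w : TangentSpace (𝓡∂ (n + 1)) x) :
    (g.inner x v w) ^ 2 ≤ g.inner x v v * g.inner x w w := by
  by_cases hw : w = 0
  · simp [hw]
  have hp := g.pos x w hw
  -- The square of this vector is `g(w,w)` times the difference of the two sides.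
  have h := inner_self_nonneg g x (g.inner x w w • v - g.inner x v w • w)
  simp only [map_sub, map_smul, sub_apply, smul_apply, smul_eq_mul, g.symm x w v] at h
  nlinarith

theorem gradNorm_nonneg (g : Metric n M) (x : M) : 0 ≤ gradNorm g φ x := Real.sqrt_nonneg _

/-- By Cauchy–Schwarz applied to `dφ(w) = g(∇φ, w)`, an upper bound of the metric suffices;
ellipticity from below is not needed. -/
theorem norm_fderivWithin_le (g : Metric n M)
    (he : e ∈ IsManifold.maximalAtlas (𝓡∂ (n + 1)) ∞ M)
    (hφ : ContMDiff (𝓡∂ (n + 1)) 𝓘(ℝ, ℝ) 1 φ) {y : EuclideanSpace ℝ (Fin (n + 1))}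
    (hy : y ∈ (e.extend (𝓡∂ (n + 1))).target) {C : ℝ} (hC : 0 ≤ C)
    (h : ∀ w, g.inner ((e.extend (𝓡∂ (n + 1))).symm y) (symmDeriv e y w) (symmDeriv e y w)
      ≤ C ^ 2 * ‖w‖ ^ 2) :
    ‖fderivWithin ℝ (φ ∘ (e.extend (𝓡∂ (n + 1))).symm) (range (𝓡∂ (n + 1))) y‖ ≤
      C * gradNorm g φ ((e.extend (𝓡∂ (n + 1))).symm y) := by
  refine ContinuousLinearMap.opNorm_le_bound _ (mul_nonneg hC (gradNorm_nonneg g _)) fun w => ?_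
  rw [fderivWithin_comp_symm he hφ hy, ← inner_gradient g]
  refine abs_le_of_sq_le_sq ?_ (mul_nonneg (mul_nonneg hC (gradNorm_nonneg g _)) (norm_nonneg w))
  refine (inner_sq_le g _ _ _).trans ?_
  have h1 : gradNorm g φ ((e.extend (𝓡∂ (n + 1))).symm y) ^ 2 =
      g.inner ((e.extend (𝓡∂ (n + 1))).symm y)
        (gradient g φ ((e.extend (𝓡∂ (n + 1))).symm y))
        (gradient g φ ((e.extend (𝓡∂ (n + 1))).symm y)) :=
    Real.sq_sqrt (inner_self_nonneg g _ _)
  rw [mul_pow, mul_pow, h1]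
  have h2 := h w
  have h3 : 0 ≤ g.inner ((e.extend (𝓡∂ (n + 1))).symm y)
        (gradient g φ ((e.extend (𝓡∂ (n + 1))).symm y))
        (gradient g φ ((e.extend (𝓡∂ (n + 1))).symm y)) := h1 ▸ sq_nonneg _
  nlinarith [mul_le_mul_of_nonneg_left h2 h3]

theorem gradNorm_comp (g : Metric n M) {h : ℝ → ℝ} {h' : ℝ} {x : M}
    (hφ : MDifferentiableAt (𝓡∂ (n + 1)) 𝓘(ℝ, ℝ) φ x) (hh : HasDerivAt h h' (φ x)) :
    gradNorm g (h ∘ φ) x = |h'| * gradNorm g φ x := by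
  have h1 : gradient g (h ∘ φ) x = h' • gradient g φ x := by
    symm
    refine eq_gradient g fun w => ?_
    rw [map_smul, smul_apply, inner_gradient]
    have h2 := mfderiv_comp x (I'' := 𝓘(ℝ, ℝ)) hh.differentiableAt.mdifferentiableAt hφ
    rw [mfderiv_eq_fderiv (f := h), hh.hasFDerivAt.fderiv] at h2
    have h3 := congrArg (fun l : TangentSpace (𝓡∂ (n + 1)) x →L[ℝ] ℝ => l w) h2
    refine Eq.trans ?_ h3.symm
    exact mul_comm (G := ℝ) _ _
  have h2 : ∀ v : TangentSpace (𝓡∂ (n + 1)) x,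
      g.inner x (h' • v) (h' • v) = h' * h' * g.inner x v v := fun v => by
    simp only [map_smul, smul_apply, smul_eq_mul]
    ring
  rw [gradNorm, h1, h2, gradNorm, Real.sqrt_mul (mul_self_nonneg _), Real.sqrt_mul_self_eq_abs]

end AFHalfSpace

namespace AFHalfSpace

variable {n : ℕ} {M : Type*} [TopologicalSpace M]
  [ChartedSpace (EuclideanHalfSpace (n + 1)) M] [IsManifold (𝓡∂ (n + 1)) ∞ M]
  {e e' : OpenPartialHomeomorph M (EuclideanHalfSpace (n + 1))} {φ : M → ℝ}

/-! ### Regions in which a chart is comparable with the Euclidean half-space -/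

/-- The chart `e` is defined on `A`, and there the metric is bounded from above and the volume
density from both sides, with constant `c`. -/
structure IsControlled (g : Metric n M)
    (e : OpenPartialHomeomorph M (EuclideanHalfSpace (n + 1)))
    (A : Set (EuclideanSpace ℝ (Fin (n + 1)))) (c : ℝ) : Prop where
  mem_maximalAtlas : e ∈ IsManifold.maximalAtlas (𝓡∂ (n + 1)) ∞ M
  isOpen : IsOpen A
  nonneg : 0 ≤ c
  subset : A ∩ range (𝓡∂ (n + 1)) ⊆ (e.extend (𝓡∂ (n + 1))).target
  density_le : ∀ y ∈ A ∩ range (𝓡∂ (n + 1)), density g e y ≤ c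
  one_le : ∀ y ∈ A ∩ range (𝓡∂ (n + 1)), 1 ≤ c * density g e y
  metric_le : ∀ y ∈ A ∩ range (𝓡∂ (n + 1)), ∀ w : EuclideanSpace ℝ (Fin (n + 1)),
    g.inner ((e.extend (𝓡∂ (n + 1))).symm y) (symmDeriv e y w) (symmDeriv e y w)
      ≤ c ^ 2 * ‖w‖ ^ 2

theorem openHalf_subset_range : openHalf n ⊆ range (𝓡∂ (n + 1)) := by
  rw [range_modelWithCornersEuclideanHalfSpace]
  exact fun y (hy : 0 < y 0) => hy.le

theorem range_mem_nhds {y : EuclideanSpace ℝ (Fin (n + 1))} (hy : y ∈ openHalf n) :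
    range (𝓡∂ (n + 1)) ∈ 𝓝 y :=
  mem_of_superset (isOpen_openHalf.mem_nhds hy) openHalf_subset_range

namespace IsControlled

variable {g : Metric n M} {A : Set (EuclideanSpace ℝ (Fin (n + 1)))} {c : ℝ}

theorem mono (h : IsControlled g e A c) {B : Set (EuclideanSpace ℝ (Fin (n + 1)))} (hB : IsOpen B)
    (hBA : B ⊆ A) : IsControlled g e B c where
  mem_maximalAtlas := h.mem_maximalAtlas
  isOpen := hB
  nonneg := h.nonneg
  subset y hy := h.subset ⟨hBA hy.1, hy.2⟩
  density_le y hy := h.density_le y ⟨hBA hy.1, hy.2⟩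
  one_le y hy := h.one_le y ⟨hBA hy.1, hy.2⟩
  metric_le y hy := h.metric_le y ⟨hBA hy.1, hy.2⟩

theorem inter_openHalf_subset (h : IsControlled g e A c) :
    A ∩ openHalf n ⊆ (e.extend (𝓡∂ (n + 1))).target := fun y hy =>
  h.subset ⟨hy.1, openHalf_subset_range hy.2⟩

theorem contDiffOn (h : IsControlled g e A c) (hφ : ContMDiff (𝓡∂ (n + 1)) 𝓘(ℝ, ℝ) 1 φ) :
    ContDiffOn ℝ 1 (φ ∘ (e.extend (𝓡∂ (n + 1))).symm) (A ∩ openHalf n) :=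
  (contDiffOn_comp_symm h.mem_maximalAtlas hφ).mono h.inter_openHalf_subset

theorem enorm_fderiv_le (h : IsControlled g e A c) (hφ : ContMDiff (𝓡∂ (n + 1)) 𝓘(ℝ, ℝ) 1 φ)
    {y : EuclideanSpace ℝ (Fin (n + 1))} (hy : y ∈ A ∩ openHalf n) :
    ‖fderiv ℝ (φ ∘ (e.extend (𝓡∂ (n + 1))).symm) y‖ₑ ≤
      ENNReal.ofReal c * ‖gradNorm g φ ((e.extend (𝓡∂ (n + 1))).symm y)‖ₑ := by
  rw [← fderivWithin_of_mem_nhds (range_mem_nhds hy.2), ← ofReal_norm, ← ofReal_norm,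
    ← ENNReal.ofReal_mul h.nonneg, Real.norm_of_nonneg (gradNorm_nonneg g _)]
  exact ENNReal.ofReal_le_ofReal (norm_fderivWithin_le g h.mem_maximalAtlas hφ
    (h.inter_openHalf_subset hy) h.nonneg (h.metric_le y ⟨hy.1, openHalf_subset_range hy.2⟩))

variable [MeasurableSpace M] [BorelSpace M] [SecondCountableTopology M] [Nonempty M]

theorem setLIntegral_eq (h : IsControlled g e A c) {f : M → ℝ≥0∞} (hf : Measurable f) :
    ∫⁻ x in e.source ∩ e.extend (𝓡∂ (n + 1)) ⁻¹' A, f x ∂(volumeMeasure g) =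
      ∫⁻ y in A ∩ openHalf n,
        ENNReal.ofReal (density g e y) * f ((e.extend (𝓡∂ (n + 1))).symm y) := by
  rw [setLIntegral_volumeMeasure g h.mem_maximalAtlas hf h.isOpen]
  refine setLIntegral_congr ?_
  have h1 : (e.extend (𝓡∂ (n + 1))).target ∩ A = A ∩ range (𝓡∂ (n + 1)) := by
    ext y
    exact ⟨fun hy => ⟨hy.2, target_subset_range hy.1⟩, fun hy => ⟨h.subset hy, hy.1⟩⟩
  rw [h1]
  exact (ae_eq_refl A).inter range_diff_openHalf_ae

theorem setLIntegral_le (h : IsControlled g e A c) {f : M → ℝ≥0∞} (hf : Measurable f) :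
    ∫⁻ x in e.source ∩ e.extend (𝓡∂ (n + 1)) ⁻¹' A, f x ∂(volumeMeasure g) ≤
      ENNReal.ofReal c * ∫⁻ y in A ∩ openHalf n, f ((e.extend (𝓡∂ (n + 1))).symm y) := by
  rw [h.setLIntegral_eq hf, ← lintegral_const_mul' _ _ ENNReal.ofReal_ne_top]
  refine setLIntegral_mono' (h.isOpen.inter isOpen_openHalf).measurableSet fun y hy => ?_
  gcongr
  exact h.density_le y ⟨hy.1, openHalf_subset_range hy.2⟩

theorem le_setLIntegral (h : IsControlled g e A c) {f : M → ℝ≥0∞} (hf : Measurable f) :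
    ∫⁻ y in A ∩ openHalf n, f ((e.extend (𝓡∂ (n + 1))).symm y) ≤ ENNReal.ofReal c *
      ∫⁻ x in e.source ∩ e.extend (𝓡∂ (n + 1)) ⁻¹' A, f x ∂(volumeMeasure g) := by
  rw [h.setLIntegral_eq hf, ← lintegral_const_mul' _ _ ENNReal.ofReal_ne_top]
  refine setLIntegral_mono' (h.isOpen.inter isOpen_openHalf).measurableSet fun y hy => ?_
  rw [← mul_assoc, ← ENNReal.ofReal_mul h.nonneg]
  refine le_mul_of_one_le_left zero_le ?_
  exact ENNReal.one_le_ofReal.2 (h.one_le y ⟨hy.1, openHalf_subset_range hy.2⟩)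

theorem lintegral_fderiv_le (h : IsControlled g e A c)
    (hφ : ContMDiff (𝓡∂ (n + 1)) 𝓘(ℝ, ℝ) 1 φ) :
    ∫⁻ y in A ∩ openHalf n, ‖fderiv ℝ (φ ∘ (e.extend (𝓡∂ (n + 1))).symm) y‖ₑ ≤
      ENNReal.ofReal (c ^ 2) * ∫⁻ x, ‖gradNorm g φ x‖ₑ ∂(volumeMeasure g) := by
  have hm : Measurable fun x => ‖gradNorm g φ x‖ₑ := (continuous_gradNorm g hφ).enorm.measurable
  refine (setLIntegral_mono' (h.isOpen.inter isOpen_openHalf).measurableSet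
    fun y hy => h.enorm_fderiv_le hφ hy).trans ?_
  rw [lintegral_const_mul' _ _ ENNReal.ofReal_ne_top, sq, ENNReal.ofReal_mul h.nonneg, mul_assoc]
  refine mul_le_mul_right ((h.le_setLIntegral hm).trans ?_) _
  exact mul_le_mul_right (setLIntegral_le_lintegral _ _) _

end IsControlled

theorem inner_symmDeriv_le (g : Metric n M) {y : EuclideanSpace ℝ (Fin (n + 1))} {b : ℝ}
    (hb : ∀ i j, |coeff g e i j y| ≤ b) (w : EuclideanSpace ℝ (Fin (n + 1))) :
    g.inner ((e.extend (𝓡∂ (n + 1))).symm y) (symmDeriv e y w) (symmDeriv e y w)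
      ≤ b * (n + 1) ^ 2 * ‖w‖ ^ 2 := by
  rw [inner_symmDeriv]
  have hw : ∀ i, |w i| ≤ ‖w‖ := fun i => PiLp.norm_apply_le w i
  calc ∑ i, ∑ j, w i * w j * coeff g e i j y
      ≤ ∑ _i : Fin (n + 1), ∑ _j : Fin (n + 1), ‖w‖ * ‖w‖ * b := by
        refine Finset.sum_le_sum fun i _ => Finset.sum_le_sum fun j _ => ?_
        refine (le_abs_self _).trans ?_
        rw [abs_mul, abs_mul]
        gcongr
        · exact hw i
        · exact hw j
        · exact hb i j
    _ = _ := by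
        simp only [Finset.sum_const, Finset.card_univ, Fintype.card_fin, nsmul_eq_mul]
        push_cast
        ring

theorem exists_isControlled_of_bounds (g : Metric n M)
    (he : e ∈ IsManifold.maximalAtlas (𝓡∂ (n + 1)) ∞ M)
    {A : Set (EuclideanSpace ℝ (Fin (n + 1)))} (hA : IsOpen A)
    (hAt : A ∩ range (𝓡∂ (n + 1)) ⊆ (e.extend (𝓡∂ (n + 1))).target) {a b d : ℝ} (ha : 0 < a)
    (hda : ∀ y ∈ A ∩ range (𝓡∂ (n + 1)), a ≤ density g e y)
    (hdd : ∀ y ∈ A ∩ range (𝓡∂ (n + 1)), density g e y ≤ d)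
    (hb : ∀ y ∈ A ∩ range (𝓡∂ (n + 1)), ∀ i j, |coeff g e i j y| ≤ b) :
    ∃ c, IsControlled g e A c := by
  -- One constant dominates all the bounds. Being at least one, it is below its own square, which is
  -- what the metric bound asks for.
  have hc1 : (1 : ℝ) ≤ 1 + a⁻¹ + |d| + |b| * (n + 1) ^ 2 := by
    have := inv_pos.2 ha
    have : 0 ≤ |b| * (n + 1 : ℝ) ^ 2 := by positivity
    linarith [abs_nonneg d]
  have hca : a⁻¹ ≤ 1 + a⁻¹ + |d| + |b| * (n + 1) ^ 2 := by
    have : 0 ≤ |b| * (n + 1 : ℝ) ^ 2 := by positivity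
    linarith [abs_nonneg d]
  have hcd : d ≤ 1 + a⁻¹ + |d| + |b| * (n + 1) ^ 2 := by
    have := inv_pos.2 ha
    have : 0 ≤ |b| * (n + 1 : ℝ) ^ 2 := by positivity
    linarith [le_abs_self d]
  have hcb : |b| * (n + 1) ^ 2 ≤ 1 + a⁻¹ + |d| + |b| * (n + 1) ^ 2 := by
    have := inv_pos.2 ha
    linarith [abs_nonneg d]
  refine ⟨1 + a⁻¹ + |d| + |b| * (n + 1) ^ 2, he, hA, by linarith, hAt,
    fun y hy => (hdd y hy).trans hcd, fun y hy => ?_, fun y hy w => ?_⟩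
  · calc (1 : ℝ) = a⁻¹ * a := (inv_mul_cancel₀ ha.ne').symm
      _ ≤ _ := by
        have := hda y hy
        gcongr
  · refine (inner_symmDeriv_le g (b := |b|) (fun i j => (hb y hy i j).trans (le_abs_self b)) w).trans
      ?_
    refine mul_le_mul_of_nonneg_right ?_ (sq_nonneg _)
    nlinarith

theorem exists_isControlled_of_isCompact (g : Metric n M)
    (he : e ∈ IsManifold.maximalAtlas (𝓡∂ (n + 1)) ∞ M)
    {A K : Set (EuclideanSpace ℝ (Fin (n + 1)))} (hA : IsOpen A) (hK : IsCompact K)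
    (hKt : K ⊆ (e.extend (𝓡∂ (n + 1))).target) (hAK : A ∩ range (𝓡∂ (n + 1)) ⊆ K) :
    ∃ c, IsControlled g e A c := by
  obtain ⟨d, hd⟩ := hK.exists_bound_of_continuousOn ((continuousOn_density g he).mono hKt)
  -- The lower bound of the density comes from an upper bound of its reciprocal.
  have hinv : ContinuousOn (fun y => (density g e y)⁻¹) K :=
    ((continuousOn_density g he).mono hKt).inv₀ fun y hy => (density_pos g he (hKt hy)).ne'
  obtain ⟨a, ha⟩ := hK.exists_bound_of_continuousOn hinv
  have hG : ContinuousOn (fun y => ∑ i, ∑ j, |coeff g e i j y|) K :=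
    continuousOn_finsetSum _ fun i _ => continuousOn_finsetSum _ fun j _ =>
      ((continuousOn_coeff g he i j).mono hKt).abs
  obtain ⟨b, hb⟩ := hK.exists_bound_of_continuousOn hG
  refine exists_isControlled_of_bounds g he hA (hAK.trans hKt) (a := (|a| + 1)⁻¹) (b := b) (d := d)
    (by positivity) (fun y hy => ?_) (fun y hy => (le_abs_self _).trans (hd y (hAK hy)))
    (fun y hy i j => ?_)
  · have h1 := density_pos g he (hKt (hAK hy))
    have h2 := ha y (hAK hy)
    rw [Real.norm_of_nonneg (inv_pos.2 h1).le] at h2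
    rw [inv_le_comm₀ (by positivity) h1]
    linarith [le_abs_self a]
  · refine le_trans ?_ ((le_abs_self _).trans (hb y (hAK hy)))
    refine le_trans ?_ (Finset.single_le_sum (f := fun i => ∑ j, |coeff g e i j y|)
      (fun i _ => Finset.sum_nonneg fun j _ => abs_nonneg _) (Finset.mem_univ i))
    exact Finset.single_le_sum (f := fun j => |coeff g e i j y|)
      (fun j _ => abs_nonneg _) (Finset.mem_univ j)

theorem exists_isControlled_ball (g : Metric n M) (x : M) : ∃ r > 0, ∃ c,
    IsControlled g (chartAt (EuclideanHalfSpace (n + 1)) x)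
      (Metric.ball (extChartAt (𝓡∂ (n + 1)) x x) r) c := by
  set e := chartAt (EuclideanHalfSpace (n + 1)) x
  have he : e ∈ IsManifold.maximalAtlas (𝓡∂ (n + 1)) ∞ M := IsManifold.chart_mem_maximalAtlas x
  have hx : extChartAt (𝓡∂ (n + 1)) x x ∈ (e.extend (𝓡∂ (n + 1))).target :=
    mem_extChartAt_target x
  obtain ⟨r, hr, hrt⟩ := Metric.mem_nhdsWithin_iff.1 (target_mem_nhdsWithin hx)
  refine ⟨r / 2, half_pos hr, exists_isControlled_of_isCompact g he Metric.isOpen_ball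
    (K := Metric.closedBall (extChartAt (𝓡∂ (n + 1)) x x) (r / 2) ∩ range (𝓡∂ (n + 1)))
    ((isCompact_closedBall _ _).inter_right isClosed_range_model) (fun y hy => hrt ⟨?_, hy.2⟩)
    (inter_subset_inter_left _ Metric.ball_subset_closedBall)⟩
  exact Metric.closedBall_subset_ball (half_lt_self hr) hy.1

/-! ### The end -/

theorem exists_det_bounds : ∃ ε > 0, ε ≤ 1 ∧ ∀ G : Matrix (Fin (n + 1)) (Fin (n + 1)) ℝ,
    (∀ i j, |G i j - (if i = j then 1 else 0)| ≤ ε) → 1 / 4 ≤ G.det ∧ G.det ≤ 4 := by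
  have hc : Continuous fun G : Fin (n + 1) → Fin (n + 1) → ℝ => (Matrix.of G).det :=
    Continuous.matrix_det continuous_id
  have h1 : (Matrix.of fun i j : Fin (n + 1) => if i = j then (1 : ℝ) else 0).det = 1 := by
    have : (Matrix.of fun i j : Fin (n + 1) => if i = j then (1 : ℝ) else 0) = 1 := by
      ext i j; simp [Matrix.one_apply]
    rw [this, Matrix.det_one]
  have hn : Icc (1 / 4 : ℝ) 4 ∈ 𝓝 ((Matrix.of fun i j : Fin (n + 1) =>
      if i = j then (1 : ℝ) else 0).det) := by
    rw [h1]; exact Icc_mem_nhds (by norm_num) (by norm_num)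
  obtain ⟨ε, hε, hb⟩ := Metric.mem_nhds_iff.1 (hc.continuousAt.preimage_mem_nhds hn)
  refine ⟨min 1 (ε / 2), by positivity, min_le_left _ _, fun G hG => ?_⟩
  refine hb (a := fun i j => G i j) ?_
  rw [Metric.mem_ball, dist_pi_lt_iff hε]
  intro i
  rw [dist_pi_lt_iff hε]
  intro j
  rw [Real.dist_eq]
  exact ((hG i j).trans (min_le_right _ _)).trans_lt (half_lt_self hε)

/-- Far out the Gram matrix is so close to the identity that its determinant lies in `[1/4, 4]`.
Only the `C⁰` part of the decay enters; the derivative terms are dropped as nonnegative. -/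
theorem IsEndChart.exists_isControlled {g : Metric n M}
    {Φ : OpenPartialHomeomorph M (EuclideanHalfSpace (n + 1))} {R τ : ℝ} (hτ : 0 < τ)
    (hΦ : IsEndChart g Φ R τ) : ∃ R₂, R < R₂ ∧ 0 < R₂ ∧ ∃ c,
      IsControlled g Φ {y | R₂ < ‖y‖} c := by
  obtain ⟨ε, hε, hε1, hdet⟩ := exists_det_bounds (n := n)
  obtain ⟨C, R₁, hC⟩ := hΦ.decay
  have hlim : Tendsto (fun t : ℝ => C * t ^ (-τ)) atTop (𝓝 0) := by
    simpa using (tendsto_rpow_neg_atTop hτ).const_mul C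
  obtain ⟨R₀, hR₀⟩ := eventually_atTop.1 (hlim.eventually_le_const hε)
  have hopen : IsOpen {y : EuclideanSpace ℝ (Fin (n + 1)) | |R| + |R₁| + |R₀| + 1 < ‖y‖} :=
    isOpen_lt continuous_const continuous_norm
  have hsub : {y | |R| + |R₁| + |R₀| + 1 < ‖y‖} ∩ range (𝓡∂ (n + 1)) ⊆
      (Φ.extend (𝓡∂ (n + 1))).target := by
    rintro _ ⟨hy, z, rfl⟩
    rw [Φ.extend_target']
    refine mem_image_of_mem _ (hΦ.subset_target ?_)
    have hy' : |R| + |R₁| + |R₀| + 1 < ‖z.val‖ := hy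
    have : R ≤ ‖z.val‖ := by linarith [le_abs_self R, abs_nonneg R₁, abs_nonneg R₀]
    exact this
  have hco : ∀ y ∈ {y | |R| + |R₁| + |R₀| + 1 < ‖y‖} ∩ range (𝓡∂ (n + 1)), ∀ i j,
      |coeff g Φ i j y - (if i = j then 1 else 0)| ≤ ε := by
    rintro y ⟨hy, hyr⟩ i j
    have hy' : |R| + |R₁| + |R₀| + 1 < ‖y‖ := hy
    rw [range_modelWithCornersEuclideanHalfSpace] at hyr
    have h1 := hC y hyr (by linarith [le_abs_self R, abs_nonneg R₁, abs_nonneg R₀])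
      (by linarith [le_abs_self R₁, abs_nonneg R, abs_nonneg R₀]) i j
    have h2 : 0 ≤ ∑ k, ‖y‖ * |partialDeriv k (coeff g Φ i j) y| :=
      Finset.sum_nonneg fun k _ => by positivity
    have h3 : 0 ≤ ∑ k, ∑ l, ‖y‖ ^ 2 * |partialDeriv k (partialDeriv l (coeff g Φ i j)) y| :=
      Finset.sum_nonneg fun k _ => Finset.sum_nonneg fun l _ => by positivity
    have h4 := hR₀ ‖y‖ (by linarith [le_abs_self R₀, abs_nonneg R, abs_nonneg R₁])
    linarith
  refine ⟨|R| + |R₁| + |R₀| + 1, by linarith [le_abs_self R, abs_nonneg R₁, abs_nonneg R₀],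
    by positivity, exists_isControlled_of_bounds g hΦ.mem_maximalAtlas hopen hsub
    (a := Real.sqrt (1 / 4)) (d := Real.sqrt 4) (b := 2) (by positivity) (fun y hy => ?_)
    (fun y hy => ?_) (fun y hy i j => ?_)⟩
  · exact Real.sqrt_le_sqrt (hdet (gram g Φ y) (hco y hy)).1
  · exact Real.sqrt_le_sqrt (hdet (gram g Φ y) (hco y hy)).2
  · have h := hco y hy i j
    rw [abs_le] at h ⊢
    split_ifs at h <;> constructor <;> linarith

end AFHalfSpace

namespace AFHalfSpace

variable {n : ℕ} {M : Type*} [TopologicalSpace M]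
  [ChartedSpace (EuclideanHalfSpace (n + 1)) M] [IsManifold (𝓡∂ (n + 1)) ∞ M]
  {e Φ : OpenPartialHomeomorph M (EuclideanHalfSpace (n + 1))} {φ : M → ℝ}

/-! ### Local finiteness of the volume -/

theorem extend_preimage_mem_nhds_of_mem {x : M} (hx : x ∈ e.source)
    {A : Set (EuclideanSpace ℝ (Fin (n + 1)))} (hA : IsOpen A)
    (hxA : e.extend (𝓡∂ (n + 1)) x ∈ A) :
    e.source ∩ e.extend (𝓡∂ (n + 1)) ⁻¹' A ∈ 𝓝 x :=
  (e.isOpen_extend_preimage hA).mem_nhds ⟨hx, hxA⟩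

variable [MeasurableSpace M] [BorelSpace M] [SecondCountableTopology M] [Nonempty M]

theorem isFiniteMeasureOnCompacts_volumeMeasure (g : Metric n M) :
    IsFiniteMeasureOnCompacts (volumeMeasure g) := by
  have : IsLocallyFiniteMeasure (volumeMeasure g) := by
    refine ⟨fun x => ?_⟩
    obtain ⟨r, hr, c, hc⟩ := exists_isControlled_ball g x
    refine ⟨_, extend_preimage_mem_nhds_of_mem (mem_chart_source _ x) hc.isOpen
      (Metric.mem_ball_self hr), ?_⟩
    have h := hc.setLIntegral_le (f := fun _ => 1) measurable_const
    rw [setLIntegral_one, setLIntegral_one] at h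
    exact h.trans_lt (ENNReal.mul_lt_top ENNReal.ofReal_lt_top
      ((measure_mono inter_subset_left).trans_lt measure_ball_lt_top))
  infer_instance

/-! ### Compact sets do not reach infinity -/

/-- Moving a point by `(T + 1) e_0` never decreases its norm, and at height at least `T + 1` any two
points are joined by a segment whose height, hence norm, exceeds `T`. -/
theorem isPreconnected_exterior {T : ℝ} (hT : 0 ≤ T) :
    IsPreconnected {z : EuclideanHalfSpace (n + 1) | T < ‖z.val‖} := by
  have hup : ∀ x : EuclideanSpace ℝ (Fin (n + 1)), 0 ≤ x 0 → ∀ s : ℝ, 0 ≤ s →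
      ‖x‖ ≤ ‖x + s • EuclideanSpace.single 0 (1 : ℝ)‖ := by
    intro x hx s hs
    refine le_of_sq_le_sq ?_ (norm_nonneg _)
    rw [norm_add_sq_real, inner_smul_right, EuclideanSpace.inner_single_right]
    simp only [conj_trivial, one_mul]
    nlinarith [sq_nonneg ‖s • EuclideanSpace.single (0 : Fin (n + 1)) (1 : ℝ)‖, mul_nonneg hs hx]
  have hlow : ∀ x : EuclideanSpace ℝ (Fin (n + 1)), x 0 ≤ ‖x‖ := fun x =>
    (le_abs_self _).trans (PiLp.norm_apply_le x 0)
  have key : IsPreconnected {y : EuclideanSpace ℝ (Fin (n + 1)) | 0 ≤ y 0 ∧ T < ‖y‖} := by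
    refine isPreconnected_of_forall_pair fun x hx y hy => ?_
    set w : EuclideanSpace ℝ (Fin (n + 1)) := (T + 1) • EuclideanSpace.single 0 (1 : ℝ) with hw
    have hw0 : w 0 = T + 1 := by simp [hw]
    have hseg : ∀ x : EuclideanSpace ℝ (Fin (n + 1)), 0 ≤ x 0 → T < ‖x‖ →
        segment ℝ x (x + w) ⊆ {y | 0 ≤ y 0 ∧ T < ‖y‖} := by
      intro x hx hxT z hz
      rw [segment_eq_image'] at hz
      obtain ⟨θ, hθ, rfl⟩ := hz
      simp only [add_sub_cancel_left]
      refine ⟨?_, ?_⟩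
      · simp only [PiLp.add_apply, PiLp.smul_apply, hw0, smul_eq_mul]
        have := mul_nonneg hθ.1 (by linarith : 0 ≤ T + 1)
        linarith
      · rw [hw, smul_smul]
        exact hxT.trans_le (hup x hx _ (mul_nonneg hθ.1 (by linarith)))
    have htop : segment ℝ (x + w) (y + w) ⊆ {y | 0 ≤ y 0 ∧ T < ‖y‖} := by
      rintro z ⟨a, b, ha, hb, hab, rfl⟩
      have h0 : (a • (x + w) + b • (y + w)) 0 = a * x 0 + b * y 0 + (T + 1) := by
        simp only [PiLp.add_apply, PiLp.smul_apply, hw0, smul_eq_mul]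
        linear_combination (T + 1) * hab
      have h1 := mul_nonneg ha hx.1
      have h2 := mul_nonneg hb hy.1
      refine ⟨by rw [h0]; linarith, lt_of_lt_of_le ?_ (hlow _)⟩
      rw [h0]; linarith
    refine ⟨segment ℝ x (x + w) ∪ segment ℝ (x + w) (y + w) ∪ segment ℝ y (y + w),
      union_subset (union_subset (hseg x hx.1 hx.2) htop) (hseg y hy.1 hy.2),
      Or.inl (Or.inl (left_mem_segment _ _ _)), Or.inr (left_mem_segment _ _ _), ?_⟩
    exact (IsPreconnected.union (x + w) (right_mem_segment _ _ _) (left_mem_segment _ _ _)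
      (convex_segment _ _).isPreconnected (convex_segment _ _).isPreconnected).union (y + w)
      (Or.inr (right_mem_segment _ _ _)) (right_mem_segment _ _ _)
      (convex_segment _ _).isPreconnected
  have himg : {z : EuclideanHalfSpace (n + 1) | T < ‖z.val‖} =
      (𝓡∂ (n + 1)).symm '' {y : EuclideanSpace ℝ (Fin (n + 1)) | 0 ≤ y 0 ∧ T < ‖y‖} := by
    ext z
    constructor
    · intro hz
      exact ⟨z.val, ⟨z.property, hz⟩, (𝓡∂ (n + 1)).left_inv z⟩
    · rintro ⟨y, ⟨hy, hyT⟩, rfl⟩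
      have hyr : y ∈ range (𝓡∂ (n + 1)) := by
        rw [range_modelWithCornersEuclideanHalfSpace]; exact hy
      have h1 : ((𝓡∂ (n + 1)).symm y).val = y := (𝓡∂ (n + 1)).right_inv hyr
      change T < ‖((𝓡∂ (n + 1)).symm y).val‖
      rw [h1]; exact hyT
  rw [himg]
  exact key.image _ (𝓡∂ (n + 1)).continuous_symm.continuousOn

namespace IsEndChart

variable {g : Metric n M} {R τ : ℝ}

theorem exists_bound_of_isCompact [T2Space M] (hΦ : IsEndChart g Φ R τ) {S : Set M}
    (hS : IsCompact S)
    (hSK : S ⊆ Φ.symm '' {y : EuclideanHalfSpace (n + 1) | R < ‖y.val‖}) :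
    ∃ T, ∀ z : EuclideanHalfSpace (n + 1), R ≤ ‖z.val‖ → T < ‖z.val‖ → Φ.symm z ∉ S := by
  have hSs : S ⊆ Φ.source := by
    intro x hx
    obtain ⟨z, hz, rfl⟩ := hSK hx
    exact Φ.map_target (hΦ.subset_target (show R ≤ ‖z.val‖ from (show R < ‖z.val‖ from hz).le))
  have hc : IsCompact (Φ '' S) := hS.image_of_continuousOn (Φ.continuousOn.mono hSs)
  obtain ⟨T, hT⟩ := hc.exists_bound_of_continuousOn
    (f := fun z : EuclideanHalfSpace (n + 1) => z.val) continuous_subtype_val.continuousOn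
  refine ⟨T, fun z hzR hzT hzS => ?_⟩
  have h := hT z ⟨_, hzS, Φ.right_inv (hΦ.subset_target hzR)⟩
  exact absurd h (not_le.2 hzT)

/-- Enclose the core in the interior of a compact `K'`. The frontier of that interior is a compact
part of the end, hence bounded in the chart, so the connected far end lies either inside the
interior or outside its closure. The first is impossible by volume; in the second, the part of `S`
outside the interior is again a compact part of the end, hence bounded. -/
theorem exists_notMem_of_isCompact [T2Space M] (hτ : 0 < τ) (hΦ : IsEndChart g Φ R τ) {S : Set M}
    (hS : IsCompact S) :
    ∃ T, ∀ z : EuclideanHalfSpace (n + 1), T < ‖z.val‖ → Φ.symm z ∉ S := by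
  haveI : LocallyCompactSpace M := Manifold.locallyCompact_of_finiteDimensional (𝓡∂ (n + 1))
  haveI := isFiniteMeasureOnCompacts_volumeMeasure g
  obtain ⟨K', hK', hKK'⟩ := exists_compact_superset hΦ.isCompact_core
  have hfr : IsCompact (frontier (interior K')) :=
    hK'.of_isClosed_subset isClosed_frontier
      (frontier_subset_closure.trans (closure_minimal interior_subset hK'.isClosed))
  have hcompl : ∀ {s : Set M}, Disjoint s (interior K') →
      s ⊆ Φ.symm '' {y : EuclideanHalfSpace (n + 1) | R < ‖y.val‖} := by
    intro s hs x hx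
    by_contra h
    exact disjoint_left.1 hs hx (hKK' h)
  obtain ⟨T₁, hT₁⟩ := hΦ.exists_bound_of_isCompact hfr (hcompl (by
    rw [isOpen_interior.frontier_eq]; exact disjoint_sdiff_left))
  obtain ⟨T₂, hT₂⟩ := hΦ.exists_bound_of_isCompact (hS.diff isOpen_interior)
    (hcompl disjoint_sdiff_left)
  obtain ⟨R₂, hR₂, hR₂0, c, hc⟩ := hΦ.exists_isControlled hτ
  set T := |T₁| + |T₂| + R₂ with hT
  have hTR : R₂ ≤ T := by linarith [abs_nonneg T₁, abs_nonneg T₂]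
  have hTT : T₁ ≤ T := by linarith [le_abs_self T₁, abs_nonneg T₂]
  have hTT2 : T₂ ≤ T := by linarith [le_abs_self T₂, abs_nonneg T₁]
  set P := Φ.symm '' {z : EuclideanHalfSpace (n + 1) | T < ‖z.val‖} with hP
  have hPc : IsPreconnected P :=
    (isPreconnected_exterior (hR₂0.le.trans hTR)).image _ (Φ.continuousOn_symm.mono
      fun z (hz : T < ‖z.val‖) => hΦ.subset_target (show R ≤ ‖z.val‖ by linarith))
  have hcover : P ⊆ interior K' ∪ (closure (interior K'))ᶜ := by
    rintro _ ⟨z, hz, rfl⟩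
    have hz' : T < ‖z.val‖ := hz
    have := hT₁ z (by linarith) (by linarith)
    rw [isOpen_interior.frontier_eq] at this
    by_cases h : Φ.symm z ∈ interior K'
    · exact Or.inl h
    · exact Or.inr fun h2 => this ⟨h2, h⟩
  rcases hPc.subset_or_subset isOpen_interior isClosed_closure.isOpen_compl
    (disjoint_compl_right.mono_left subset_closure) hcover with h | h
  -- The far end has infinite volume by comparison with the Euclidean exterior, whereas `K'` has
  -- finite volume.
  · exfalso
    have hopen : IsOpen {y : EuclideanSpace ℝ (Fin (n + 1)) | T < ‖y‖} :=
      isOpen_lt continuous_const continuous_norm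
    have hc' := hc.mono hopen fun y (hy : T < ‖y‖) => hTR.trans_lt hy
    have h1 := hc'.le_setLIntegral (f := fun _ => 1) measurable_const
    rw [setLIntegral_one, setLIntegral_one, volume_exterior] at h1
    have h2 : Φ.source ∩ Φ.extend (𝓡∂ (n + 1)) ⁻¹' {y | T < ‖y‖} ⊆ K' := by
      rintro x ⟨hx, hxT⟩
      exact interior_subset (h ⟨Φ x, hxT, Φ.left_inv hx⟩)
    have h3 : ENNReal.ofReal c * volumeMeasure g
        (Φ.source ∩ Φ.extend (𝓡∂ (n + 1)) ⁻¹' {y | T < ‖y‖}) < ⊤ :=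
      ENNReal.mul_lt_top ENNReal.ofReal_lt_top ((measure_mono h2).trans_lt hK'.measure_lt_top)
    exact absurd h1 (not_le.2 h3)
  · refine ⟨T, fun z hz hzS => ?_⟩
    by_cases hzi : Φ.symm z ∈ interior K'
    · exact h ⟨z, hz, rfl⟩ (subset_closure hzi)
    · exact hT₂ z (by linarith) (by linarith) ⟨hzS, hzi⟩

theorem exists_eq_zero [T2Space M] (hτ : 0 < τ) (hΦ : IsEndChart g Φ R τ)
    (hφ : HasCompactSupport φ) :
    ∃ T, ∀ y ∈ range (𝓡∂ (n + 1)), T ≤ ‖y‖ → (φ ∘ (Φ.extend (𝓡∂ (n + 1))).symm) y = 0 := by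
  obtain ⟨T, hT⟩ := hΦ.exists_notMem_of_isCompact hτ hφ
  refine ⟨T + 1, ?_⟩
  rintro _ ⟨z, rfl⟩ hz
  have hz' : T + 1 ≤ ‖z.val‖ := hz
  have h := hT z (by linarith)
  rw [Function.comp, Φ.extend_coe_symm, Function.comp, (𝓡∂ (n + 1)).left_inv]
  exact image_eq_zero_of_notMem_tsupport h

end IsEndChart

end AFHalfSpace

namespace AFHalfSpace

variable {n : ℕ} {M : Type*} [TopologicalSpace M]
  [ChartedSpace (EuclideanHalfSpace (n + 1)) M] [IsManifold (𝓡∂ (n + 1)) ∞ M]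
  {e Φ : OpenPartialHomeomorph M (EuclideanHalfSpace (n + 1))} {φ : M → ℝ}
  [MeasurableSpace M] [BorelSpace M] [SecondCountableTopology M] [Nonempty M]

/-! ### Bounds by the total variation -/

/-- The total variation `∫ |∇φ|`. -/
def variation (g : Metric n M) (φ : M → ℝ) : ℝ≥0∞ := ∫⁻ x, ‖gradNorm g φ x‖ₑ ∂(volumeMeasure g)

/-- On `U`, the `L^q`-norm of `C¹` functions with compact support in `M` is controlled by their
total variation on `M`. -/
def IsBoundedByVariation (g : Metric n M) (q : ℝ) (U : Set M) : Prop :=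
  ∃ C : ℝ≥0∞, C ≠ ⊤ ∧ ∀ φ : M → ℝ, ContMDiff (𝓡∂ (n + 1)) 𝓘(ℝ, ℝ) 1 φ → HasCompactSupport φ →
    ∫⁻ x in U, ‖φ x‖ₑ ^ q ∂(volumeMeasure g) ≤ (C * variation g φ) ^ q

theorem IsBoundedByVariation.mono {g : Metric n M} {q : ℝ} {U V : Set M}
    (h : IsBoundedByVariation g q V) (hUV : U ⊆ V) : IsBoundedByVariation g q U := by
  obtain ⟨C, hC, h⟩ := h
  exact ⟨C, hC, fun φ h1 h2 => (lintegral_mono_set hUV).trans (h φ h1 h2)⟩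

/-- Superadditivity of `t ↦ t ^ q` for `q ≥ 1` lets the constants simply add. -/
theorem IsBoundedByVariation.union {g : Metric n M} {q : ℝ} (hq : 1 ≤ q) {U V : Set M}
    (hU : IsBoundedByVariation g q U) (hV : IsBoundedByVariation g q V) :
    IsBoundedByVariation g q (U ∪ V) := by
  obtain ⟨C, hC, hU⟩ := hU
  obtain ⟨D, hD, hV⟩ := hV
  refine ⟨C + D, ENNReal.add_ne_top.2 ⟨hC, hD⟩, fun φ h1 h2 => ?_⟩
  refine (lintegral_union_le _ _ _).trans ((add_le_add (hU φ h1 h2) (hV φ h1 h2)).trans ?_)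
  rw [add_mul]
  exact ENNReal.add_rpow_le_rpow_add _ _ hq

theorem mul_rpow_le_rpow {q : ℝ} (hq : 1 ≤ q) (a b : ℝ≥0∞) : a * b ^ q ≤ ((a + 1) * b) ^ q := by
  rw [ENNReal.mul_rpow_of_nonneg _ _ (by linarith)]
  refine mul_le_mul_left ?_ _
  calc a ≤ a + 1 := le_self_add
    _ = (a + 1) ^ (1 : ℝ) := (ENNReal.rpow_one _).symm
    _ ≤ _ := ENNReal.rpow_le_rpow_of_exponent_le le_add_self hq

theorem measurable_enorm_rpow (hφ : ContMDiff (𝓡∂ (n + 1)) 𝓘(ℝ, ℝ) 1 φ) (q : ℝ) :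
    Measurable fun x => ‖φ x‖ₑ ^ q :=
  hφ.continuous.enorm.measurable.pow_const q

namespace IsEndChart

variable {g : Metric n M} {R τ : ℝ} [T2Space M]

/-- The source of all `L¹` bounds. Rays in the direction `e_0` increase the norm, so they remain in
the exterior region and reach the zeros of `φ`; the constant does not depend on how far out these
are. -/
theorem exists_lintegral_inter_ball_le (hτ : 0 < τ) (hΦ : IsEndChart g Φ R τ) {R₂ c : ℝ}
    (hc : IsControlled g Φ {y | R₂ < ‖y‖} c) (ρ : ℝ) :
    ∀ φ : M → ℝ, ContMDiff (𝓡∂ (n + 1)) 𝓘(ℝ, ℝ) 1 φ → HasCompactSupport φ →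
    ∫⁻ y in ({y | R₂ < ‖y‖} ∩ openHalf n) ∩ Metric.ball 0 ρ,
      ‖(φ ∘ (Φ.extend (𝓡∂ (n + 1))).symm) y‖ₑ ≤
        ENNReal.ofReal (2 * ρ) * (ENNReal.ofReal (c ^ 2) * variation g φ) := by
  intro φ hφ hφc
  obtain ⟨T, hT⟩ := hΦ.exists_eq_zero hτ hφc
  have hO := hc.isOpen.inter (isOpen_openHalf (n := n))
  refine (lintegral_le_lintegral_ray volume hO (hc.contDiffOn hφ)
    (hO.measurableSet.inter measurableSet_ball) inter_subset_left
    (w := EuclideanSpace.single 0 (1 : ℝ)) (by simp) ?_ (T := T)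
    (fun y hy h => hT y (openHalf_subset_range hy.2) h) (ρ := ρ)
    (EuclideanSpace.proj (0 : Fin (n + 1))) (by simp) ?_).trans
    (mul_le_mul_right (hc.lintegral_fderiv_le hφ) _)
  · rintro x ⟨hx, hx0⟩ s hs
    refine ⟨show R₂ < ‖_‖ from lt_of_lt_of_le (show R₂ < ‖x‖ from hx) ?_, add_smul_single_mem_openHalf hx0 0 hs⟩
    have hx0' : 0 < x 0 := hx0
    refine le_of_sq_le_sq ?_ (norm_nonneg _)
    rw [norm_add_sq_real, inner_smul_right, EuclideanSpace.inner_single_right]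
    simp only [conj_trivial, one_mul]
    nlinarith [sq_nonneg ‖s • EuclideanSpace.single (0 : Fin (n + 1)) (1 : ℝ)‖,
      mul_nonneg hs hx0'.le]
  · rintro x ⟨_, hx⟩
    exact (PiLp.norm_apply_le x 0).trans (mem_ball_zero_iff.1 hx).le

end IsEndChart

/-! ### Transfer between charts and the manifold, and propagation of the `L¹` bound -/

theorem IsControlled.isBoundedByVariation {g : Metric n M}
    {A : Set (EuclideanSpace ℝ (Fin (n + 1)))} {c q : ℝ} (hq : 1 ≤ q) (h : IsControlled g e A c)
    {C : ℝ≥0∞} (hC : C ≠ ⊤)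
    (hA : ∀ φ : M → ℝ, ContMDiff (𝓡∂ (n + 1)) 𝓘(ℝ, ℝ) 1 φ → HasCompactSupport φ →
      ∫⁻ y in A ∩ openHalf n, ‖(φ ∘ (e.extend (𝓡∂ (n + 1))).symm) y‖ₑ ^ q ≤
        (C * variation g φ) ^ q) :
    IsBoundedByVariation g q (e.source ∩ e.extend (𝓡∂ (n + 1)) ⁻¹' A) := by
  refine ⟨(ENNReal.ofReal c + 1) * C, ENNReal.mul_ne_top (by simp) hC, fun φ h1 h2 => ?_⟩
  refine (h.setLIntegral_le (measurable_enorm_rpow h1 q)).trans ?_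
  refine (mul_le_mul_right (hA φ h1 h2) _).trans ?_
  rw [mul_assoc]
  exact mul_rpow_le_rpow hq _ _

theorem IsControlled.lintegral_le {g : Metric n M}
    {A : Set (EuclideanSpace ℝ (Fin (n + 1)))} {c : ℝ} (h : IsControlled g e A c) {U : Set M}
    (hAU : e.source ∩ e.extend (𝓡∂ (n + 1)) ⁻¹' A ⊆ U) (hU : IsBoundedByVariation g 1 U) :
    ∃ C : ℝ≥0∞, C ≠ ⊤ ∧ ∀ φ : M → ℝ, ContMDiff (𝓡∂ (n + 1)) 𝓘(ℝ, ℝ) 1 φ → HasCompactSupport φ →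
      ∫⁻ y in A ∩ openHalf n, ‖(φ ∘ (e.extend (𝓡∂ (n + 1))).symm) y‖ₑ ≤ C * variation g φ := by
  obtain ⟨C, hC, hU⟩ := hU
  refine ⟨ENNReal.ofReal c * C, ENNReal.mul_ne_top ENNReal.ofReal_ne_top hC, fun φ h1 h2 => ?_⟩
  refine (h.le_setLIntegral h1.continuous.enorm.measurable).trans ?_
  rw [mul_assoc]
  refine mul_le_mul_right ((lintegral_mono_set hAU).trans ?_) _
  simpa only [ENNReal.rpow_one] using hU φ h1 h2

theorem symm_mem_of_mem {y : EuclideanSpace ℝ (Fin (n + 1))}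
    (hy : y ∈ (e.extend (𝓡∂ (n + 1))).target) : (e.extend (𝓡∂ (n + 1))).symm y ∈ e.source := by
  simpa using (e.extend (𝓡∂ (n + 1))).map_target hy

theorem IsEndChart.exists_isBoundedByVariation_nhds [T2Space M] {g : Metric n M} {R τ : ℝ}
    (hτ : 0 < τ) (hΦ : IsEndChart g Φ R τ) : ∃ x, ∃ U ∈ 𝓝 x, IsBoundedByVariation g 1 U := by
  obtain ⟨R₂, hR₂, hR₂0, c, hc⟩ := hΦ.exists_isControlled hτ
  set A := {y : EuclideanSpace ℝ (Fin (n + 1)) | R₂ < ‖y‖} ∩ Metric.ball 0 (R₂ + 2) with hA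
  have hcA : IsControlled g Φ A c := hc.mono (hc.isOpen.inter Metric.isOpen_ball) inter_subset_left
  set y : EuclideanSpace ℝ (Fin (n + 1)) := (R₂ + 1) • EuclideanSpace.single 0 (1 : ℝ) with hy
  have hyn : ‖y‖ = R₂ + 1 := by
    rw [hy, norm_smul, Real.norm_of_nonneg (by linarith)]; simp
  have hyA : y ∈ A := by
    refine ⟨?_, ?_⟩
    · change R₂ < ‖y‖; rw [hyn]; linarith
    · rw [mem_ball_zero_iff, hyn]; linarith
  have hyh : y ∈ openHalf n := by
    change 0 < y 0
    simp [hy]; linarith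
  have hyt := hcA.inter_openHalf_subset ⟨hyA, hyh⟩
  refine ⟨(Φ.extend (𝓡∂ (n + 1))).symm y, _, extend_preimage_mem_nhds_of_mem (symm_mem_of_mem hyt)
    hcA.isOpen (by rwa [(Φ.extend (𝓡∂ (n + 1))).right_inv hyt]),
    hcA.isBoundedByVariation le_rfl
    (C := ENNReal.ofReal (2 * (R₂ + 2)) * ENNReal.ofReal (c ^ 2))
    (ENNReal.mul_ne_top ENNReal.ofReal_ne_top ENNReal.ofReal_ne_top) fun φ h1 h2 => ?_⟩
  simp only [ENNReal.rpow_one]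
  rw [hA, inter_right_comm, mul_assoc]
  exact hΦ.exists_lintegral_inter_ball_le hτ hc _ φ h1 h2

theorem exists_extend_preimage_ball_subset {x : M} (hx : x ∈ e.source) {U : Set M}
    (hU : U ∈ 𝓝 x) : ∃ r > 0, e.source ∩ e.extend (𝓡∂ (n + 1)) ⁻¹'
      (Metric.ball (e.extend (𝓡∂ (n + 1)) x) r) ⊆ U := by
  have h := e.extend_preimage_mem_nhdsWithin (I := 𝓡∂ (n + 1)) hx
    (mem_nhdsWithin_of_mem_nhds (t := univ) hU)
  rw [preimage_univ, univ_inter] at h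
  obtain ⟨r, hr, hrU⟩ := Metric.mem_nhdsWithin_iff.1 h
  refine ⟨r, hr, fun z hz => ?_⟩
  have := hrU ⟨hz.2, mem_range_self (f := 𝓡∂ (n + 1)) _⟩
  rwa [mem_preimage, e.extend_left_inv hz.1] at this

/-- A bound near a point of a half-ball propagates to the center. -/
theorem IsControlled.isBoundedByVariation_center {g : Metric n M} {x x₁ : M} {r c : ℝ}
    (hr : 0 < r) (hx : x ∈ e.source) (h : IsControlled g e
      (Metric.ball (e.extend (𝓡∂ (n + 1)) x) r) c)
    (hx₁ : x₁ ∈ e.source ∩ e.extend (𝓡∂ (n + 1)) ⁻¹' (Metric.ball (e.extend (𝓡∂ (n + 1)) x) r))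
    {U : Set M} (hU : U ∈ 𝓝 x₁) (hUb : IsBoundedByVariation g 1 U) :
    ∃ V ∈ 𝓝 x, IsBoundedByVariation g 1 V := by
  set z := e.extend (𝓡∂ (n + 1)) x with hz
  set z₁ := e.extend (𝓡∂ (n + 1)) x₁ with hz₁
  have hrange : ∀ x : M, 0 ≤ e.extend (𝓡∂ (n + 1)) x 0 := fun x => by
    have : e.extend (𝓡∂ (n + 1)) x ∈ range (𝓡∂ (n + 1)) := mem_range_self _
    rwa [range_modelWithCornersEuclideanHalfSpace] at this
  obtain ⟨r₁, hr₁, hr₁U⟩ := exists_extend_preimage_ball_subset hx₁.1 hU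
  obtain ⟨δ, hδ, hδs⟩ := Metric.isOpen_iff.1
    ((Metric.isOpen_ball (x := z₁) (ε := r₁)).inter (Metric.isOpen_ball (x := z) (ε := r))) z₁
    ⟨Metric.mem_ball_self hr₁, hx₁.2⟩
  -- The point `z₁` may lie on the boundary. Pushing it inwards leaves room for a full ball around
  -- `z₀` in the open half-space, into which the half-ball around `z` is translated.
  set z₀ := z₁ + (δ / 2) • EuclideanSpace.single (0 : Fin (n + 1)) (1 : ℝ) with hz₀
  have hz₀h : z₀ ∈ openHalf n := by
    change 0 < z₀ 0
    have := hrange x₁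
    simp [hz₀]
    linarith
  have hz₀b : z₀ ∈ Metric.ball z₁ δ := by
    rw [mem_ball_iff_norm, hz₀, add_sub_cancel_left, norm_smul, Real.norm_of_nonneg (by positivity)]
    simp; exact hδ
  obtain ⟨ρ, hρ, hρs⟩ := Metric.isOpen_iff.1
    ((Metric.isOpen_ball (x := z₁) (ε := δ)).inter (isOpen_openHalf (n := n))) z₀ ⟨hz₀b, hz₀h⟩
  have hVr : Metric.ball z₀ ρ ⊆ Metric.ball z r := fun y hy => (hδs (hρs hy).1).2
  have hVh : Metric.ball z₀ ρ ⊆ openHalf n := fun y hy => (hρs hy).2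
  have hcV := h.mono Metric.isOpen_ball hVr
  obtain ⟨C, hC, hCV⟩ := hcV.lintegral_le (fun w hw => hr₁U ⟨hw.1, (hδs (hρs hw.2).1).1⟩) hUb
  have hAr : Metric.ball z (min ρ r) ⊆ Metric.ball z r := Metric.ball_subset_ball (min_le_right _ _)
  have hcA := h.mono Metric.isOpen_ball hAr
  refine ⟨_, extend_preimage_mem_nhds_of_mem hx hcA.isOpen
    (Metric.mem_ball_self (lt_min hρ hr)), hcA.isBoundedByVariation le_rfl
    (C := C + ‖z₀ - z‖ₑ * ENNReal.ofReal (c ^ 2)) (ENNReal.add_ne_top.2 ⟨hC,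
      ENNReal.mul_ne_top enorm_ne_top ENNReal.ofReal_ne_top⟩) fun φ h1 h2 => ?_⟩
  simp only [ENNReal.rpow_one]
  refine (lintegral_le_lintegral_translate volume (h.isOpen.inter isOpen_openHalf)
    ((convex_ball z r).inter convex_openHalf) (h.contDiffOn h1)
    (measurableSet_ball.inter measurableSet_openHalf) (V := Metric.ball z₀ ρ) measurableSet_ball
    (a := z₀ - z) (inter_subset_inter_left _ hAr) (subset_inter hVr hVh) ?_).trans ?_
  · rintro y ⟨hy, _⟩
    rw [mem_ball_iff_norm] at hy ⊢
    rw [show y + (z₀ - z) - z₀ = y - z by abel]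
    exact hy.trans_le (min_le_left _ _)
  · rw [add_mul, mul_assoc]
    refine add_le_add ?_ (mul_le_mul_right (h.lintegral_fderiv_le h1) _)
    have := hCV φ h1 h2
    rwa [inter_eq_left.2 hVh] at this

/-- The set of good points is open by definition, closed by propagation to centers of controlled
balls, and nonempty because of the end. -/
theorem exists_isBoundedByVariation_nhds [ConnectedSpace M] [T2Space M] {g : Metric n M} {R τ : ℝ}
    (hτ : 0 < τ) (hΦ : IsEndChart g Φ R τ) (x : M) :
    ∃ U ∈ 𝓝 x, IsBoundedByVariation g 1 U := by
  set S := {x : M | ∃ U ∈ 𝓝 x, IsBoundedByVariation g 1 U} with hS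
  have hopen : IsOpen S := by
    rw [isOpen_iff_mem_nhds]
    rintro x ⟨U, hU, hb⟩
    filter_upwards [eventually_mem_nhds_iff.2 hU] with y hy
    exact ⟨U, hy, hb⟩
  have hclosed : IsClosed S := by
    refine isClosed_of_closure_subset fun x hx => ?_
    obtain ⟨r, hr, c, hc⟩ := exists_isControlled_ball g x
    obtain ⟨x₁, hx₁, U, hU, hb⟩ := mem_closure_iff_nhds.1 hx _ (extend_preimage_mem_nhds_of_mem
      (mem_chart_source (EuclideanHalfSpace (n + 1)) x) hc.isOpen (Metric.mem_ball_self hr))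
    exact hc.isBoundedByVariation_center hr (mem_chart_source _ x) hx₁ hU hb
  have hne : S.Nonempty := hΦ.exists_isBoundedByVariation_nhds hτ
  have := IsClopen.eq_univ ⟨hclosed, hopen⟩ hne
  exact (this ▸ mem_univ x : x ∈ S)

/-! ### The Sobolev inequality with exponent one -/

theorem one_le_exponent (hn : 1 ≤ n) : (1 : ℝ) ≤ (n + 1 : ℝ) / n := by
  have hn0 : (0 : ℝ) < n := by exact_mod_cast hn
  rw [le_div_iff₀ hn0]; linarith

theorem exists_isBoundedByVariation_rpow_nhds [ConnectedSpace M] [T2Space M] (hn : 1 ≤ n)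
    {g : Metric n M} {R τ : ℝ} (hτ : 0 < τ) (hΦ : IsEndChart g Φ R τ) (x : M) :
    ∃ U ∈ 𝓝 x, IsBoundedByVariation g ((n + 1 : ℝ) / n) U := by
  obtain ⟨U, hU, hb⟩ := exists_isBoundedByVariation_nhds hτ hΦ x
  obtain ⟨r, hr, c, hc⟩ := exists_isControlled_ball g x
  have hxs := mem_chart_source (EuclideanHalfSpace (n + 1)) x
  obtain ⟨r₁, hr₁, hr₁U⟩ := exists_extend_preimage_ball_subset hxs hU
  set z := extChartAt (𝓡∂ (n + 1)) x x with hz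
  set s := min r r₁ with hs
  have hs0 : 0 < s := lt_min hr hr₁
  have hcs := hc.mono Metric.isOpen_ball (Metric.ball_subset_ball (min_le_left r r₁))
  obtain ⟨C, hC, hCb⟩ := hcs.lintegral_le (fun w hw => hr₁U ⟨hw.1,
    Metric.ball_subset_ball (min_le_right _ _) hw.2⟩) hb
  obtain ⟨L, hL⟩ := exists_lintegral_ball_rpow_le hn z hs0
  have hc3 := hcs.mono (Metric.isOpen_ball (x := z) (ε := s / 3))
    (Metric.ball_subset_ball (by linarith))
  refine ⟨_, extend_preimage_mem_nhds_of_mem hxs hc3.isOpen (Metric.mem_ball_self (by linarith)),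
    hc3.isBoundedByVariation (one_le_exponent hn)
    (C := ENNReal.ofReal (c ^ 2) + ENNReal.ofReal L * C) (ENNReal.add_ne_top.2
      ⟨ENNReal.ofReal_ne_top, ENNReal.mul_ne_top ENNReal.ofReal_ne_top hC⟩) fun φ h1 h2 => ?_⟩
  refine (hL _ (hcs.contDiffOn h1)).trans (ENNReal.rpow_le_rpow ?_ (by positivity))
  rw [add_mul, mul_assoc]
  exact add_le_add (hcs.lintegral_fderiv_le h1) (mul_le_mul_right (hCb φ h1 h2) _)

theorem IsEndChart.isBoundedByVariation_rpow_end [T2Space M] (hn : 1 ≤ n)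
    {g : Metric n M} {R τ : ℝ} (hτ : 0 < τ) (hΦ : IsEndChart g Φ R τ) :
    ∃ R₃, R < R₃ ∧ IsBoundedByVariation g ((n + 1 : ℝ) / n)
      (Φ.source ∩ Φ.extend (𝓡∂ (n + 1)) ⁻¹' {y | R₃ < ‖y‖}) := by
  obtain ⟨R₂, hR₂, hR₂0, c, hc⟩ := hΦ.exists_isControlled hτ
  obtain ⟨L, hL⟩ := exists_lintegral_exterior_rpow_le hn hR₂0
  have hc2 := hc.mono (B := {y | R₂ + 2 < ‖y‖}) (isOpen_lt continuous_const continuous_norm)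
    fun y (hy : R₂ + 2 < ‖y‖) => show R₂ < ‖y‖ by linarith
  refine ⟨R₂ + 2, by linarith, hc2.isBoundedByVariation (one_le_exponent hn)
    (C := ENNReal.ofReal (c ^ 2) + ENNReal.ofReal L * (ENNReal.ofReal (2 * (R₂ + 3)) *
      ENNReal.ofReal (c ^ 2))) (ENNReal.add_ne_top.2 ⟨ENNReal.ofReal_ne_top,
        ENNReal.mul_ne_top ENNReal.ofReal_ne_top (ENNReal.mul_ne_top ENNReal.ofReal_ne_top
          ENNReal.ofReal_ne_top)⟩) fun φ h1 h2 => ?_⟩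
  obtain ⟨T, hT⟩ := hΦ.exists_eq_zero hτ h2
  refine (hL _ T (hc.contDiffOn h1)
    fun y hy h => hT y (openHalf_subset_range hy.2) h).trans
    (ENNReal.rpow_le_rpow ?_ (by positivity))
  rw [add_mul, mul_assoc, mul_assoc]
  exact add_le_add (hc.lintegral_fderiv_le h1)
    (mul_le_mul_right (hΦ.exists_lintegral_inter_ball_le hτ hc _ φ h1 h2) _)

theorem IsEndChart.isCompact_compl [T2Space M]
    {g : Metric n M} {R τ : ℝ} (hΦ : IsEndChart g Φ R τ) (R₃ : ℝ) :
    ∃ S : Set M, IsCompact S ∧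
      S ∪ (Φ.source ∩ Φ.extend (𝓡∂ (n + 1)) ⁻¹' {y | R₃ < ‖y‖}) = univ := by
  set Q := {z : EuclideanHalfSpace (n + 1) | R ≤ ‖z.val‖ ∧ ‖z.val‖ ≤ R₃} with hQ
  have hQc : IsCompact Q := by
    have hcl : Topology.IsClosedEmbedding (𝓡∂ (n + 1)) := (𝓡∂ (n + 1)).isClosedEmbedding
    have hcont : Continuous fun z : EuclideanHalfSpace (n + 1) => ‖z.val‖ :=
      continuous_norm.comp continuous_subtype_val
    refine (hcl.isCompact_preimage (isCompact_closedBall 0 R₃)).of_isClosed_subset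
      ((isClosed_le continuous_const hcont).inter (isClosed_le hcont continuous_const)) ?_
    intro z hz
    exact mem_closedBall_zero_iff.2 hz.2
  refine ⟨_, hΦ.isCompact_core.union (hQc.image_of_continuousOn (Φ.continuousOn_symm.mono
    fun z hz => hΦ.subset_target hz.1)), eq_univ_of_forall fun x => ?_⟩
  by_cases hx : x ∈ Φ.symm '' {y : EuclideanHalfSpace (n + 1) | R < ‖y.val‖}
  · obtain ⟨z, hz, rfl⟩ := hx
    have hz' : R < ‖z.val‖ := hz
    have hzt : z ∈ Φ.target := hΦ.subset_target hz'.le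
    rcases le_or_gt ‖z.val‖ R₃ with h | h
    · exact Or.inl (Or.inr ⟨z, ⟨hz'.le, h⟩, rfl⟩)
    · refine Or.inr ⟨Φ.map_target hzt, ?_⟩
      change R₃ < ‖(Φ (Φ.symm z)).val‖
      rwa [Φ.right_inv hzt]
  · exact Or.inl (Or.inl hx)

theorem exists_lintegral_rpow_le_variation [ConnectedSpace M] [T2Space M] (hn : 1 ≤ n)
    {g : Metric n M} (hg : IsAsymptoticallyFlatHalfSpace g) :
    ∃ C : ℝ≥0∞, C ≠ ⊤ ∧ ∀ φ : M → ℝ, ContMDiff (𝓡∂ (n + 1)) 𝓘(ℝ, ℝ) 1 φ → HasCompactSupport φ →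
    ∫⁻ x, ‖φ x‖ₑ ^ ((n + 1 : ℝ) / n) ∂(volumeMeasure g) ≤
      (C * variation g φ) ^ ((n + 1 : ℝ) / n) := by
  obtain ⟨Φ, R, τ, hR, hτ, hΦ⟩ := hg
  obtain ⟨R₃, hR₃, hend⟩ := hΦ.isBoundedByVariation_rpow_end hn hτ
  obtain ⟨S, hS, hSu⟩ := hΦ.isCompact_compl R₃
  -- Compactness induction replaces the choice of a finite subcover.
  have hSb : IsBoundedByVariation g ((n + 1 : ℝ) / n) S := by
    refine hS.induction_on (p := IsBoundedByVariation g ((n + 1 : ℝ) / n)) ?_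
      (fun s t hst ht => ht.mono hst) (fun s t hs ht => hs.union (one_le_exponent hn) ht)
      fun x _ => ?_
    · exact ⟨0, ENNReal.zero_ne_top, fun φ _ _ => by simp⟩
    · obtain ⟨U, hU, hb⟩ := exists_isBoundedByVariation_rpow_nhds hn hτ hΦ x
      exact ⟨U, mem_nhdsWithin_of_mem_nhds hU, hb⟩
  have := hSb.union (one_le_exponent hn) hend
  rw [hSu] at this
  simpa only [IsBoundedByVariation, Measure.restrict_univ] using this

end AFHalfSpace

namespace AFHalfSpace

variable {n : ℕ} {M : Type*} [TopologicalSpace M]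
  [ChartedSpace (EuclideanHalfSpace (n + 1)) M] [IsManifold (𝓡∂ (n + 1)) ∞ M] {φ : M → ℝ}

/-! ### General exponents -/

theorem abs_deriv_abs_rpow {γ : ℝ} (hγ : 1 < γ) (t : ℝ) :
    |γ * |t| ^ (γ - 2) * t| = γ * |t| ^ (γ - 1) := by
  rcases eq_or_ne t 0 with rfl | ht
  · rw [mul_zero, abs_zero, Real.zero_rpow (by linarith), mul_zero]
  · rw [abs_mul, abs_mul, abs_of_pos (by linarith : 0 < γ),
      abs_of_nonneg (Real.rpow_nonneg (abs_nonneg t) _), mul_assoc,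
      show γ - 1 = (γ - 2) + 1 by ring, Real.rpow_add (abs_pos.2 ht), Real.rpow_one]

theorem hasCompactSupport_gradNorm [T2Space M] (g : Metric n M) (hφ : HasCompactSupport φ) :
    HasCompactSupport (gradNorm g φ) := by
  refine HasCompactSupport.intro hφ fun x hx => ?_
  have h := (notMem_tsupport_iff_eventuallyEq.1 hx).mfderiv_eq
    (I := 𝓡∂ (n + 1)) (I' := 𝓘(ℝ, ℝ))
  have h0 : (0 : TangentSpace (𝓡∂ (n + 1)) x) = gradient g φ x := by
    refine eq_gradient g fun w => ?_
    rw [map_zero, h]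
    exact (congrArg (fun l : TangentSpace (𝓡∂ (n + 1)) x →L[ℝ] ℝ => l w)
      (mfderiv_const (I := 𝓡∂ (n + 1)) (I' := 𝓘(ℝ, ℝ)) (c := (0 : ℝ)) (x := x))).symm
  rw [gradNorm, ← h0, map_zero, Real.sqrt_zero]

theorem lintegral_enorm_rpow_eq {X : Type*} [TopologicalSpace X] [MeasurableSpace X]
    [BorelSpace X] {μ : Measure X} [IsFiniteMeasureOnCompacts μ] {f : X → ℝ} (hf : Continuous f)
    (hc : HasCompactSupport f) {r : ℝ} (hr : 0 < r) :
    Integrable (fun x => |f x| ^ r) μ ∧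
      ∫⁻ x, ‖f x‖ₑ ^ r ∂μ = ENNReal.ofReal (∫ x, |f x| ^ r ∂μ) := by
  have hi : Integrable (fun x => |f x| ^ r) μ := by
    refine Continuous.integrable_of_hasCompactSupport
      (hf.abs.rpow_const fun x => Or.inr hr.le) ?_
    exact hc.comp_left (g := fun t : ℝ => |t| ^ r) (by simp [hr.ne'])
  refine ⟨hi, ?_⟩
  rw [ofReal_integral_eq_lintegral_ofReal hi
    (ae_of_all _ fun x => Real.rpow_nonneg (abs_nonneg _) _)]
  refine lintegral_congr fun x => ?_
  rw [← ENNReal.ofReal_rpow_of_nonneg (abs_nonneg _) hr.le, ← Real.norm_eq_abs, ofReal_norm]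

variable [MeasurableSpace M] [BorelSpace M] [SecondCountableTopology M] [Nonempty M]

theorem variation_abs_rpow (g : Metric n M) {γ : ℝ} (hγ : 1 < γ)
    (hφ : ContMDiff (𝓡∂ (n + 1)) 𝓘(ℝ, ℝ) 1 φ) :
    variation g (fun x => |φ x| ^ γ) = ENNReal.ofReal γ *
      ∫⁻ x, (‖φ x‖ₑ ^ (γ - 1)) * ‖gradNorm g φ x‖ₑ ∂(volumeMeasure g) := by
  rw [variation, ← lintegral_const_mul' _ _ ENNReal.ofReal_ne_top]
  refine lintegral_congr fun x => ?_
  have h := gradNorm_comp g ((hφ x).mdifferentiableAt (by simp)) (hasDerivAt_abs_rpow (φ x) hγ)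
  rw [abs_deriv_abs_rpow hγ] at h
  have h2 : gradNorm g (fun x => |φ x| ^ γ) x = γ * |φ x| ^ (γ - 1) * gradNorm g φ x := h
  have h3 : ‖|φ x| ^ (γ - 1)‖ₑ = ‖φ x‖ₑ ^ (γ - 1) := by
    rw [Real.enorm_of_nonneg (Real.rpow_nonneg (abs_nonneg _) _),
      ← ENNReal.ofReal_rpow_of_nonneg (abs_nonneg _) (by linarith), ← Real.norm_eq_abs, ofReal_norm]
  rw [h2, enorm_mul, enorm_mul, h3, Real.enorm_of_nonneg (by linarith : 0 ≤ γ), mul_assoc]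

/-- The factor by which the Sobolev constant grows when passing from exponent `1` to `p`. -/
def exponentFactor (n : ℕ) (p : ℝ) : ℝ := p * n / (n + 1 - p)

/-- The exponent `γ` satisfies both `γ(n+1)/n = p*` and `(γ-1)p' = p*`, with `p'` conjugate to `p`.
After Hölder the same integral `X` thus stands on both sides, and its power on the right cancels
because `X` is finite. -/
theorem lintegral_rpow_le (hn : 1 ≤ n) {g : Metric n M} {C : ℝ≥0∞}
    (hC : ∀ φ : M → ℝ, ContMDiff (𝓡∂ (n + 1)) 𝓘(ℝ, ℝ) 1 φ → HasCompactSupport φ →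
      ∫⁻ x, ‖φ x‖ₑ ^ ((n + 1 : ℝ) / n) ∂(volumeMeasure g) ≤
        (C * variation g φ) ^ ((n + 1 : ℝ) / n)) {p : ℝ} (hp1 : 1 < p) (hpn : p < n + 1)
    (hφ : ContMDiff (𝓡∂ (n + 1)) 𝓘(ℝ, ℝ) 1 φ) (hφc : HasCompactSupport φ)
    (hfin : ∫⁻ x, ‖φ x‖ₑ ^ sobolevExponent n p ∂(volumeMeasure g) ≠ ⊤) :
    (∫⁻ x, ‖φ x‖ₑ ^ sobolevExponent n p ∂(volumeMeasure g)) ^ (1 / sobolevExponent n p) ≤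
      C * ENNReal.ofReal (exponentFactor n p) *
        (∫⁻ x, ‖gradNorm g φ x‖ₑ ^ p ∂(volumeMeasure g)) ^ (1 / p) := by
  have hn0 : (0 : ℝ) < n := by exact_mod_cast hn
  have hd : 0 < (n + 1 : ℝ) - p := by linarith
  have hp0 : 0 < p := by linarith
  set P := sobolevExponent n p with hP
  set γ := exponentFactor n p with hγdef
  have hPe : P = (n + 1) * p / (n + 1 - p) := rfl
  have hγe : γ = p * n / (n + 1 - p) := rfl
  have hP0 : 0 < P := by rw [hPe]; positivity
  have hγ : 1 < γ := by
    rw [hγe, one_lt_div hd]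
    nlinarith
  have hγP : γ * ((n + 1 : ℝ) / n) = P := by rw [hγe, hPe]; field_simp
  set X := ∫⁻ x, ‖φ x‖ₑ ^ P ∂(volumeMeasure g) with hX
  set Y := ∫⁻ x, ‖gradNorm g φ x‖ₑ ^ p ∂(volumeMeasure g) with hY
  have hconj : (p.conjExponent).HolderConjugate p := (Real.HolderConjugate.conjExponent hp1).symm
  have hp' : p.conjExponent = p / (p - 1) := rfl
  have hγp : (γ - 1) * p.conjExponent = P := by
    have h1 : p - 1 ≠ 0 := by linarith
    rw [hγe, hPe, hp']
    field_simp
    ring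
  rcases eq_or_ne X 0 with h0 | h0
  · rw [h0, ENNReal.zero_rpow_of_pos (by positivity)]; exact zero_le
  -- This power need not be smooth where `φ` vanishes, which is why the estimate with exponent one
  -- is proved for `C¹` functions.
  have hψ : ContMDiff (𝓡∂ (n + 1)) 𝓘(ℝ, ℝ) 1 (fun x => |φ x| ^ γ) := by
    have h1 : ContDiff ℝ 1 (fun t : ℝ => ‖t‖ ^ γ) := contDiff_norm_rpow hγ
    exact h1.contMDiff.comp hφ
  have hψc : HasCompactSupport (fun x => |φ x| ^ γ) :=
    hφc.comp_left (g := fun t : ℝ => |t| ^ γ) (by simp [(by linarith : γ ≠ 0)])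
  have h1 := hC _ hψ hψc
  have h2 : ∫⁻ x, ‖|φ x| ^ γ‖ₑ ^ ((n + 1 : ℝ) / n) ∂(volumeMeasure g) = X := by
    refine lintegral_congr fun x => ?_
    rw [Real.enorm_of_nonneg (Real.rpow_nonneg (abs_nonneg _) _),
      ← ENNReal.ofReal_rpow_of_nonneg (abs_nonneg _) (by linarith), ← Real.norm_eq_abs,
      ofReal_norm, ← ENNReal.rpow_mul, hγP]
  rw [h2, variation_abs_rpow g hγ hφ] at h1
  have h3 : ∫⁻ x, (‖φ x‖ₑ ^ (γ - 1)) * ‖gradNorm g φ x‖ₑ ∂(volumeMeasure g) ≤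
      X ^ (1 / p.conjExponent) * Y ^ (1 / p) := by
    have := ENNReal.lintegral_mul_le_Lp_mul_Lq (volumeMeasure g) hconj
      (measurable_enorm_rpow hφ (γ - 1)).aemeasurable
      (continuous_gradNorm g hφ).enorm.measurable.aemeasurable
    simp only [← ENNReal.rpow_mul, hγp] at this
    exact this
  have h4 : X ^ ((n : ℝ) / (n + 1)) ≤
      C * (ENNReal.ofReal γ * (X ^ (1 / p.conjExponent) * Y ^ (1 / p))) := by
    have h5 : X ≤ (C * (ENNReal.ofReal γ * (X ^ (1 / p.conjExponent) * Y ^ (1 / p)))) ^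
        ((n + 1 : ℝ) / n) := by
      refine h1.trans (ENNReal.rpow_le_rpow ?_ (by positivity))
      gcongr
    have h6 := ENNReal.rpow_le_rpow h5 (by positivity : 0 ≤ (n : ℝ) / (n + 1))
    rwa [← ENNReal.rpow_mul, show (n + 1 : ℝ) / n * (n / (n + 1)) = 1 by field_simp,
      ENNReal.rpow_one] at h6
  have hexp : 1 / P = (n : ℝ) / (n + 1) + -(1 / p.conjExponent) := by
    have h1 : p - 1 ≠ 0 := by linarith
    rw [hPe, hp']
    field_simp
    ring
  calc X ^ (1 / P) = X ^ ((n : ℝ) / (n + 1)) * X ^ (-(1 / p.conjExponent)) := by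
        rw [hexp, ENNReal.rpow_add _ _ h0 hfin]
    _ ≤ C * (ENNReal.ofReal γ * (X ^ (1 / p.conjExponent) * Y ^ (1 / p))) *
          X ^ (-(1 / p.conjExponent)) := mul_le_mul_left h4 _
    _ = C * ENNReal.ofReal γ * Y ^ (1 / p) *
          (X ^ (1 / p.conjExponent) * X ^ (-(1 / p.conjExponent))) := by ring
    _ = _ := by
        rw [← ENNReal.rpow_add _ _ h0 hfin, add_neg_cancel, ENNReal.rpow_zero, mul_one]

theorem sobolevInequality_of_variation [T2Space M] (hn : 1 ≤ n) {g : Metric n M} {C : ℝ≥0∞}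
    (hCt : C ≠ ⊤)
    (hC : ∀ φ : M → ℝ, ContMDiff (𝓡∂ (n + 1)) 𝓘(ℝ, ℝ) 1 φ → HasCompactSupport φ →
      ∫⁻ x, ‖φ x‖ₑ ^ ((n + 1 : ℝ) / n) ∂(volumeMeasure g) ≤
        (C * variation g φ) ^ ((n + 1 : ℝ) / n)) {p : ℝ} (hp1 : 1 < p) (hpn : p < n + 1) :
    0 < (C.toReal + 1) * exponentFactor n p ∧
      SobolevInequality g p ((C.toReal + 1) * exponentFactor n p) := by
  have hn0 : (0 : ℝ) < n := by exact_mod_cast hn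
  have hd : 0 < (n + 1 : ℝ) - p := by linarith
  have hp0 : 0 < p := by linarith
  have hγ0 : 0 < exponentFactor n p := by rw [exponentFactor]; positivity
  have hP0 : 0 < sobolevExponent n p := by rw [sobolevExponent]; positivity
  -- Adding one keeps the constant positive even if `C = 0`.
  have hK0 : 0 < (C.toReal + 1) * exponentFactor n p := by
    have := C.toReal_nonneg
    positivity
  refine ⟨hK0, fun φ hφ hφc => ?_⟩
  haveI := isFiniteMeasureOnCompacts_volumeMeasure g
  have hφ1 : ContMDiff (𝓡∂ (n + 1)) 𝓘(ℝ, ℝ) 1 φ := hφ.of_le (by simp)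
  obtain ⟨hi, hX⟩ := lintegral_enorm_rpow_eq (μ := volumeMeasure g) hφ.continuous hφc hP0
  obtain ⟨hi', hY⟩ := lintegral_enorm_rpow_eq (μ := volumeMeasure g) (continuous_gradNorm g hφ1)
    (hasCompactSupport_gradNorm g hφc) hp0
  have habs : ∀ x, |gradNorm g φ x| = gradNorm g φ x := fun x => abs_of_nonneg (gradNorm_nonneg g x)
  simp only [habs] at hi' hY
  have hmain : (∫⁻ x, ‖φ x‖ₑ ^ sobolevExponent n p ∂(volumeMeasure g)) ^
        (1 / sobolevExponent n p) ≤ ENNReal.ofReal ((C.toReal + 1) * exponentFactor n p) *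
        (∫⁻ x, ‖gradNorm g φ x‖ₑ ^ p ∂(volumeMeasure g)) ^ (1 / p) := by
    refine (lintegral_rpow_le hn hC hp1 hpn hφ1 hφc
      (by rw [hX]; exact ENNReal.ofReal_ne_top)).trans (mul_le_mul_left ?_ _)
    rw [ENNReal.ofReal_mul (by have := C.toReal_nonneg; linarith)]
    refine mul_le_mul_left ?_ _
    calc C = ENNReal.ofReal C.toReal := (ENNReal.ofReal_toReal hCt).symm
      _ ≤ _ := ENNReal.ofReal_le_ofReal (by linarith)
  refine ⟨hi, hi', ?_, ?_⟩
  · have hI : 0 ≤ ∫ x, |φ x| ^ sobolevExponent n p ∂(volumeMeasure g) :=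
      integral_nonneg fun x => Real.rpow_nonneg (abs_nonneg _) _
    have hJ : 0 ≤ ∫ x, gradNorm g φ x ^ p ∂(volumeMeasure g) :=
      integral_nonneg fun x => Real.rpow_nonneg (gradNorm_nonneg g x) _
    rw [hX, hY, ENNReal.ofReal_rpow_of_nonneg hI (by positivity),
      ENNReal.ofReal_rpow_of_nonneg hJ (by positivity), ← ENNReal.ofReal_mul hK0.le] at hmain
    exact (ENNReal.ofReal_le_ofReal_iff (mul_nonneg hK0.le (Real.rpow_nonneg hJ _))).1 hmain
  · rw [eLpNorm_eq_lintegral_rpow_enorm_toReal (ENNReal.ofReal_pos.2 hP0).ne' ENNReal.ofReal_ne_top,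
      eLpNorm_eq_lintegral_rpow_enorm_toReal (ENNReal.ofReal_pos.2 hp0).ne' ENNReal.ofReal_ne_top,
      ENNReal.toReal_ofReal hP0.le, ENNReal.toReal_ofReal hp0.le]
    exact hmain

end AFHalfSpace

end

/-! ### Choice of the constants -/

theorem corollary7p5 (n : ℕ) {M : Type*} [TopologicalSpace M] [T2Space M]
    [SecondCountableTopology M] [ConnectedSpace M] [MeasurableSpace M] [BorelSpace M]
    [ChartedSpace (EuclideanHalfSpace (n + 1)) M] [IsManifold (𝓡∂ (n + 1)) ∞ M]
    (g : AFHalfSpace.Metric n M) (hg : AFHalfSpace.IsAsymptoticallyFlatHalfSpace g) :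
    ∃ C : ℝ → ℝ,
      (∀ p : ℝ, 1 < p → p < n + 1 → 0 < C p ∧ AFHalfSpace.SobolevInequality g p (C p)) ∧
      (n = 2 → ∃ p₀ B : ℝ, 1 < p₀ ∧ p₀ < 3 ∧ ∀ p ∈ Set.Ioc 1 p₀, C p ≤ B) := by
  -- For `n = 0` the range `1 < p < 1` is empty.
  rcases Nat.eq_zero_or_pos n with rfl | hn
  · refine ⟨fun _ => 0, fun p hp1 hp2 => ?_, fun h => by simp at h⟩
    exfalso
    push_cast at hp2
    linarith
  obtain ⟨C, hCt, hC⟩ := AFHalfSpace.exists_lintegral_rpow_le_variation hn hg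
  refine ⟨fun p => (C.toReal + 1) * AFHalfSpace.exponentFactor n p,
    fun p hp1 hp2 => AFHalfSpace.sobolevInequality_of_variation hn hCt hC hp1 hp2, ?_⟩
  rintro rfl
  -- For `n = 2` the factor `2p/(3-p)` is at most `4` exactly when `p ≤ 2`, within `p < 3`.
  refine ⟨2, (C.toReal + 1) * 4, by norm_num, by norm_num, fun p hp => ?_⟩
  refine mul_le_mul_of_nonneg_left ?_ (by have := C.toReal_nonneg; linarith)
  rw [AFHalfSpace.exponentFactor]
  push_cast
  have h2 : p ≤ 2 := hp.2
  rw [div_le_iff₀ (by linarith)]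
  linarith
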